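/- All functions, matrices and sequences are real. Let $r\in\mathbb N$, and let $L_2^r(\mathbb R)$ be the space of square integrable functions $\mathbb R\to\mathbb R^r$. Let $F:\mathbb R\to\mathbb R^{r\times r}$ be a matrix function with components in $L_2(\mathbb R)$, with columns $f^1,\dots,f^r$, and for $c=(c_k)_{k\in\mathbb Z}\in\ell_2^r(\mathbb Z)$ put $F*c=\sum_{k\in\mathbb Z}F(\cdot-k)\,c_k$ (series in $L_2^r(\mathbb R)$). Assume: - (refinable) there is a mask $A=(A_k)_{k\in\mathbb Z}$, $A_k\in\mathbb R^{r\times r}$, with $\sum_k\log(2+|k|)\,|A_k|<\infty$ (for instance a finitely supported mask, or any mask whose symbol $\sum_k A_kz^k$ converges for all $z\in\mathbb C\setminus\{0\}$), such that $F=\sum_{k}F(2\cdot-k)A_k$ in $L_2$; - (full rank) the space $\{y\in\mathbb R^r:\ A_{(0)}y=A_{(1)}y=y\}$, where $A_{(\varepsilon)}=\sum_{j\in\mathbb Z}A_{\varepsilon+2j}$, has dimension $r$; - (stable) there are constants $0<K_1\le K_2$ such that, for every $c\in\ell_2^r(\mathbb Z)$, the series $F*c$ converges in $L_2^r(\mathbb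 R)$ and $K_1\|c\|_2\le\|F*c\|_2\le K_2\|c\|_2$. Then the sets $V_j=\{(F*c)(2^j\cdot):c\in\ell_2^r(\mathbb Z)\}$, $j\in\mathbb Z$, form a multichannel multiresolution analysis of $L_2^r(\mathbb R)$, that is: 1. every $V_j$ is a closed linear subspace of $L_2^r(\mathbb R)$, and $V_j\subset V_{j+1}$; 2. for all $j,k\in\mathbb Z$ and $h\in L_2^r(\mathbb R)$: $h\in V_j$ if and only if $h(\cdot+2^{-j}k)\in V_j$; 3. for all $j\in\mathbb Z$ and $h\in L_2^r(\mathbb R)$: $h\in V_0$ if and only if $h(2^j\cdot)\in V_j$; 4. $\bigcap_{j}V_j=\{0\}$ and $\overline{\bigcup_jV_j}=L_2^r(\mathbb R)$; 5. there are $g^1,\dots,g^r\in L_2^r(\mathbb R)$ such that $V_0$ is the closed linear span of $\{g^i(\cdot-k):k\in\mathbb Z,\ 1\le i\le r\}$, and constants $0<K_1'\le K_2'$ such that for all scalar sequences $c^1,\dots,c^r\in\ell_2(\mathbb Z)$ the series below converge in $L_2^r(\mathbb R)$ and $$K_1'\Big(\sum_{i=1}^r\sum_k|c^i_k|^2\Big)^{1/2}\le\Big\|\sum_{i=1}^r\sum_kc^i_k\,g^i(\cdot-k)\Big\|_2\le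 K_2'\Big(\sum_{i=1}^r\sum_k|c^i_k|^2\Big)^{1/2}.$$ -/

import Mathlib

open MeasureTheory

namespace Multichannel

noncomputable section

/-- The space `L_2^r(ℝ)` of square integrable `ℝ^r`-valued functions on the line (classes modulo
equality almost everywhere), with `‖h‖² = ∑ j, ∫ |h_j|²`. -/
abbrev VecL2 (r : ℕ) : Type :=
  Lp (EuclideanSpace ℝ (Fin r)) 2 (volume : Measure ℝ)

/-- The space `ℓ_2^r(ℤ)` of square summable `ℝ^r`-valued sequences. -/
abbrev VecSeq2 (r : ℕ) : Type :=
  lp (fun _ : ℤ => EuclideanSpace ℝ (Fin r)) 2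

/-- `F ∈ L_2^{r×r}(ℝ)`: every component of the matrix function is square integrable. -/
def IsMatL2 {r : ℕ} (F : ℝ → Matrix (Fin r) (Fin r) ℝ) : Prop :=
  ∀ a b, MemLp (fun x => F x a b) 2 (volume : Measure ℝ)

theorem IsMatL2.memLp_column {r : ℕ} {F : ℝ → Matrix (Fin r) (Fin r) ℝ} (hF : IsMatL2 F)
    (i : Fin r) :
    MemLp (fun x => (WithLp.toLp 2 (fun a => F x a i) : EuclideanSpace ℝ (Fin r))) 2
      (volume : Measure ℝ) :=
  MemLp.of_eval_piLp fun a => hF a i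

/-- The `i`-th column `f^i` of `F = (f^1 | … | f^r)`, as an element of `L_2^r(ℝ)`. -/
def column {r : ℕ} (F : ℝ → Matrix (Fin r) (Fin r) ℝ) (hF : IsMatL2 F) (i : Fin r) : VecL2 r :=
  (hF.memLp_column i).toLp _

/-- The translate `h(· - t)`. -/
def translate {r : ℕ} (t : ℝ) (h : VecL2 r) : VecL2 r :=
  Lp.compMeasurePreserving (fun x : ℝ => x - t) (measurePreserving_sub_right volume t) h

theorem memLp_comp_mul_left {r : ℕ} (h : VecL2 r) {a : ℝ} (ha : a ≠ 0) :
    MemLp (fun x : ℝ => h (a * x)) 2 (volume : Measure ℝ) := by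
  have hm : MemLp h 2 (Measure.map (fun x : ℝ => a * x) volume) := by
    rw [Real.map_volume_mul_left ha]
    exact (Lp.memLp h).smul_measure ENNReal.ofReal_ne_top
  exact hm.comp_of_map (by fun_prop)

/-- The dilate `h(2^j ·)`, `j ∈ ℤ`. -/
def dilate {r : ℕ} (j : ℤ) (h : VecL2 r) : VecL2 r :=
  (memLp_comp_mul_left h (zpow_ne_zero j (two_ne_zero (α := ℝ)))).toLp _

/-- The function `F(· - k) v = ∑ i, v_i f^i(· - k)` of `L_2^r(ℝ)`, where `f^i` are the columns
of `F`. -/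
def translateMulVec {r : ℕ} (F : ℝ → Matrix (Fin r) (Fin r) ℝ) (hF : IsMatL2 F) (k : ℤ)
    (v : Fin r → ℝ) : VecL2 r :=
  ∑ i, v i • translate (k : ℝ) (column F hF i)

/-- The convolution `F * c = ∑ k, F(· - k) c_k`, the series being taken in `L_2^r(ℝ)`. -/
def conv {r : ℕ} (F : ℝ → Matrix (Fin r) (Fin r) ℝ) (hF : IsMatL2 F) (c : VecSeq2 r) : VecL2 r :=
  ∑' k : ℤ, translateMulVec F hF k (c k)

/-- `F` is stable: for all `c ∈ ℓ_2^r(ℤ)`, the series `F * c` converges in `L_2^r(ℝ)` and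
`K₁ ‖c‖ ≤ ‖F * c‖ ≤ K₂ ‖c‖`, with constants `0 < K₁ ≤ K₂`. -/
def IsStable {r : ℕ} (F : ℝ → Matrix (Fin r) (Fin r) ℝ) (hF : IsMatL2 F) : Prop :=
  ∃ K₁ K₂ : ℝ, 0 < K₁ ∧ K₁ ≤ K₂ ∧ ∀ c : VecSeq2 r,
    Summable (fun k : ℤ => translateMulVec F hF k (c k)) ∧
      K₁ * ‖c‖ ≤ ‖conv F hF c‖ ∧ ‖conv F hF c‖ ≤ K₂ * ‖c‖

/-- `F` is refinable with respect to the mask `A`, that is `F = ∑ k, F(2 · - k) A_k`: column by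
column, the series `F * A` converges in `L_2` to some `G`, and `F = G(2 ·)`. -/
def IsRefinable {r : ℕ} (F : ℝ → Matrix (Fin r) (Fin r) ℝ) (hF : IsMatL2 F)
    (A : ℤ → Matrix (Fin r) (Fin r) ℝ) : Prop :=
  ∃ G : Fin r → VecL2 r, ∀ i,
    HasSum (fun k : ℤ => translateMulVec F hF k (fun l => A k l i)) (G i) ∧
      column F hF i = dilate 1 (G i)

/-- The matrix `A_ε = ∑ j, A_{ε + 2j}`. -/
def subMaskSum {r : ℕ} (A : ℤ → Matrix (Fin r) (Fin r) ℝ) (ε : ℤ) : Matrix (Fin r) (Fin r) ℝ :=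
  ∑' j : ℤ, A (ε + 2 * j)

/-- The joint `1`-eigenspace `{y : A_0 y = A_1 y = y}`. -/
def jointEigenspace {r : ℕ} (A : ℤ → Matrix (Fin r) (Fin r) ℝ) : Submodule ℝ (Fin r → ℝ) :=
  Module.End.eigenspace (Matrix.toLin' (subMaskSum A 0)) 1 ⊓
    Module.End.eigenspace (Matrix.toLin' (subMaskSum A 1)) 1

/-- The mask is of full rank: its rank, the dimension of the joint `1`-eigenspace, is `r`. -/
def IsFullRank {r : ℕ} (A : ℤ → Matrix (Fin r) (Fin r) ℝ) : Prop :=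
  Module.finrank ℝ (jointEigenspace A) = r

/-- The decay `∑ k, log (2 + |k|) |A_k| < ∞` of a mask. It holds for every finitely supported
mask and, more generally, whenever the symbol `∑ k, A_k z^k` converges for all complex `z ≠ 0`. -/
def HasMaskDecay {r : ℕ} (A : ℤ → Matrix (Fin r) (Fin r) ℝ) : Prop :=
  ∀ a b, Summable fun k : ℤ => Real.log (2 + |(k : ℝ)|) * |A k a b|

/-- The translates of `f^1, …, f^r` satisfy the stability (Riesz) bounds. -/
def JointlyStable {r : ℕ} (f : Fin r → VecL2 r) : Prop :=
  ∃ K₁ K₂ : ℝ, 0 < K₁ ∧ K₁ ≤ K₂ ∧ ∀ c : Fin r → ℤ → ℝ,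
    (∀ i, Summable fun k => |c i k| ^ 2) →
      (∀ i, Summable fun k : ℤ => c i k • translate (k : ℝ) (f i)) ∧
      K₁ * √(∑ i, ∑' k, |c i k| ^ 2) ≤ ‖∑ i, ∑' k : ℤ, c i k • translate (k : ℝ) (f i)‖ ∧
      ‖∑ i, ∑' k : ℤ, c i k • translate (k : ℝ) (f i)‖ ≤ K₂ * √(∑ i, ∑' k, |c i k| ^ 2)

/-- Multichannel multiresolution analysis of `L_2^r(ℝ)`. -/
structure IsMCMRA {r : ℕ} (V : ℤ → Set (VecL2 r)) : Prop where
  /-- every `V_j` is a linear subspace … -/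
  subspace : ∀ j, ∃ W : Submodule ℝ (VecL2 r), (W : Set (VecL2 r)) = V j
  /-- … and is closed -/
  closed : ∀ j, IsClosed (V j)
  nested : ∀ j, V j ⊆ V (j + 1)
  /-- shift invariance at scale `j`: `h ∈ V_j ↔ h(· + 2^{-j} k) ∈ V_j` -/
  shift_invariant : ∀ (j k : ℤ) (h : VecL2 r),
    h ∈ V j ↔ translate (-((2 : ℝ) ^ (-j) * (k : ℝ))) h ∈ V j
  scaled : ∀ (j : ℤ) (h : VecL2 r), h ∈ V 0 ↔ dilate j h ∈ V j
  trivial_inter : ⋂ j, V j = {0}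
  dense_union : closure (⋃ j, V j) = Set.univ
  /-- `V_0` is the closed span of the stable integer translates of `r` function vectors -/
  generated : ∃ f : Fin r → VecL2 r,
    V 0 = closure (Submodule.span ℝ
        {h : VecL2 r | ∃ (i : Fin r) (k : ℤ), h = translate (k : ℝ) (f i)} : Set (VecL2 r)) ∧
      JointlyStable f

/-- `V_j = {(F * c)(2^j ·) : c ∈ ℓ_2^r(ℤ)}`. -/
def scaleSpace {r : ℕ} (F : ℝ → Matrix (Fin r) (Fin r) ℝ) (hF : IsMatL2 F) (j : ℤ) :
    Set (VecL2 r) :=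
  {h | ∃ c : VecSeq2 r, h = dilate j (conv F hF c)}

end

end Multichannel

/-!
Stability says that `c ↦ F * c` is bounded above and below, so `V_0` is its closed range and the
columns of `F` generate it. Refinability puts the columns of `F` into `V_1`, whence
`V_j ⊆ V_{j+1}`; the invariance under shifts and dilations is a change of variables. The substance
lies in the intersection and in the union of the `V_j`.

*Intersection* (`eq_zero_of_forall_mem_scaleSubmodule`). If `h ∈ V_{-n}`, then `h(2^n ·) = F * c`
with `‖c‖² ≤ K₁⁻² 2^{-n} ‖h‖²`. By the Cauchy–Schwarz inequality, the energy of `h` on `[-N, N]` is at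
most a constant times the integral over `[-2^{-n} N, 2^{-n} N]` of the integrable periodic function
`∑ i, ∑ k, |f^i(· + k)|²`, and this tends to zero.

*Union* (`eq_zero_of_forall_orthogonal`). The argument is on the Fourier side. The refinement
equation reads `F̂(x) = F̂(x/2) a(x/2)` with the symbol `a(x) = ½ ∑ k, A_k e^{-2πikx}`
(`ae_fourierMatrix_eq`), and full rank means `a(0) = 1` and `a(1/2) = 0` (`maskSymbol_zero`,
`maskSymbol_half`). Stability becomes `K₁² |v|² ≤ ∑ k, |F̂(x + k) v|² ≤ K₂² |v|²` for almost every `x`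
(`ae_gramSum_bounds`, with a harmless loss of a factor in the lower bound).

A nonzero integer is `k = 2^m (2q + 1)`, and for `t` near `0` the refinement equation gives
`F̂(t + k) = F̂(t/2^{m+1} + 1/2 + q) a(t/2^{m+1} + 1/2) a(t/2^m) ⋯ a(t/2)`. Summing the squares over
`q` with the upper bound leaves a multiple of `|a(t/2^{m+1} + 1/2)|²`, and the logarithmic decay of
the mask makes the moduli of continuity of `a` at the scales `2^{-m}` summable in `m`
(`summable_symbolModulus`). Hence the terms `k ≠ 0` of the sum `∑ k, |F̂(t + k) v|²` are together
as small as desired for `t` near `0`, the lower bound must come from `k = 0`, and `F̂(t)` is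
invertible with bounded inverse (`exists_fourierMatrix_lower_bound`). No continuity of `F̂` is needed.

If `h` is orthogonal to `V_0`, then `∑ k, ⟨ĥ(t + k), F̂(t + k) v⟩ = 0` for all `v`
(`ae_hasSum_inner_fourierMatrix`). With `v = F̂(t)⁻¹ ĥ(t)` this bounds `|ĥ(t)|²`, for `t` near `0`, by
a constant times `∑ k ≠ 0, |ĥ(t + k)|²`, so that the energy of `ĥ` on some `[-δ, δ]` is at most a
constant times its energy outside `[-1/2, 1/2]`. If `h` is orthogonal to every `V_n`, rescaling gives
the same estimate for `[-2^n δ, 2^n δ]` and `[-2^{n-1}, 2^{n-1}]`; letting `n → ∞` shows `ĥ = 0`.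
-/

namespace Multichannel

noncomputable section

/-! ### Translations and dilations -/

section

section Generic

variable {E : Type*} [NormedAddCommGroup E]

theorem enorm_sq_eq_lintegral {α : Type*} [MeasurableSpace α] {μ : Measure α} (f : Lp E 2 μ) :
    ‖f‖ₑ ^ 2 = ∫⁻ x, ‖f x‖ₑ ^ 2 ∂μ := by
  rw [Lp.enorm_def, eLpNorm_eq_lintegral_rpow_enorm_toReal (by norm_num) (by norm_num),
    ← ENNReal.rpow_natCast, ← ENNReal.rpow_mul]
  norm_num

theorem lintegral_comp_mul_left (f : ℝ → ENNReal) {a : ℝ} (ha : a ≠ 0) :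
    ∫⁻ x, f (a * x) = ENNReal.ofReal |a⁻¹| * ∫⁻ x, f x := by
  have := (Homeomorph.mulLeft₀ a ha).toMeasurableEquiv.measurableEmbedding.lintegral_map
    (μ := volume) f
  have h2 : Measure.map (fun x : ℝ => a * x) volume = ENNReal.ofReal |a⁻¹| • volume :=
    Real.map_volume_mul_left ha
  simp only [Homeomorph.toMeasurableEquiv_coe, Homeomorph.coe_mulLeft₀] at this
  rw [h2, lintegral_smul_measure] at this
  simpa using this.symm

theorem memLp_comp_mul (h : Lp E 2 (volume : Measure ℝ)) {a : ℝ} (ha : a ≠ 0) :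
    MemLp (fun x : ℝ => h (a * x)) 2 (volume : Measure ℝ) := by
  have hm : MemLp h 2 (Measure.map (fun x : ℝ => a * x) volume) := by
    rw [Real.map_volume_mul_left ha]
    exact (Lp.memLp h).smul_measure ENNReal.ofReal_ne_top
  exact hm.comp_of_map (by fun_prop)

theorem quasiMeasurePreserving_mul_left {a : ℝ} (ha : a ≠ 0) :
    Measure.QuasiMeasurePreserving (fun x : ℝ => a * x) volume volume := by
  refine ⟨by fun_prop, ?_⟩
  rw [Real.map_volume_mul_left ha]
  exact Measure.smul_absolutelyContinuous

variable [NormedSpace ℝ E]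

/-- The operator `h ↦ h(a ·)` on `L²(ℝ; E)`, for `a ≠ 0`. -/
def scaleL {a : ℝ} (ha : a ≠ 0) :
    Lp E 2 (volume : Measure ℝ) →L[ℝ] Lp E 2 (volume : Measure ℝ) :=
  LinearMap.mkContinuous
    { toFun := fun h => (memLp_comp_mul h ha).toLp _
      map_add' := fun f g => by
        ext1
        filter_upwards [(memLp_comp_mul (f + g) ha).coeFn_toLp,
          Lp.coeFn_add ((memLp_comp_mul f ha).toLp _) ((memLp_comp_mul g ha).toLp _),
          (memLp_comp_mul f ha).coeFn_toLp, (memLp_comp_mul g ha).coeFn_toLp,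
          (quasiMeasurePreserving_mul_left ha).ae (Lp.coeFn_add f g)] with x h1 h2 h3 h4 h5
        rw [h1, h2, h5, Pi.add_apply, Pi.add_apply, h3, h4]
      map_smul' := fun c f => by
        ext1
        filter_upwards [(memLp_comp_mul (c • f) ha).coeFn_toLp,
          Lp.coeFn_smul c ((memLp_comp_mul f ha).toLp _), (memLp_comp_mul f ha).coeFn_toLp,
          (quasiMeasurePreserving_mul_left ha).ae (Lp.coeFn_smul c f)] with x h1 h2 h3 h5
        simp only [RingHom.id_apply]
        rw [h1, h2, h5, Pi.smul_apply, Pi.smul_apply, h3] }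
    (√|a⁻¹|) (fun h => by
      have key : ‖(memLp_comp_mul h ha).toLp _‖ₑ ^ 2 = ENNReal.ofReal |a⁻¹| * ‖h‖ₑ ^ 2 := by
        rw [enorm_sq_eq_lintegral, enorm_sq_eq_lintegral, ← lintegral_comp_mul_left _ ha]
        refine lintegral_congr_ae ?_
        filter_upwards [(memLp_comp_mul h ha).coeFn_toLp] with x hx
        rw [hx]
      have k2 := congrArg ENNReal.toReal key
      simp only [ENNReal.toReal_mul, ENNReal.toReal_pow, toReal_enorm,
        ENNReal.toReal_ofReal (abs_nonneg _)] at k2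
      refine le_of_sq_le_sq ?_ (by positivity)
      simp only [LinearMap.coe_mk, AddHom.coe_mk]
      rw [k2, mul_pow, Real.sq_sqrt (abs_nonneg _)])

theorem coeFn_scaleL {a : ℝ} (ha : a ≠ 0) (h : Lp E 2 (volume : Measure ℝ)) :
    scaleL ha h =ᵐ[volume] fun x => h (a * x) :=
  (memLp_comp_mul h ha).coeFn_toLp

theorem enorm_scaleL_sq {a : ℝ} (ha : a ≠ 0) (h : Lp E 2 (volume : Measure ℝ)) :
    ‖scaleL ha h‖ₑ ^ 2 = ENNReal.ofReal |a⁻¹| * ‖h‖ₑ ^ 2 := by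
  rw [enorm_sq_eq_lintegral, enorm_sq_eq_lintegral, ← lintegral_comp_mul_left _ ha]
  refine lintegral_congr_ae ?_
  filter_upwards [coeFn_scaleL ha h] with x hx
  rw [hx]

/-- The translation `h ↦ h(· - t)` on `L²(ℝ; E)`, as a linear isometry. -/
def shiftL (t : ℝ) : Lp E 2 (volume : Measure ℝ) →ₗᵢ[ℝ] Lp E 2 (volume : Measure ℝ) :=
  Lp.compMeasurePreservingₗᵢ ℝ (fun x : ℝ => x - t) (measurePreserving_sub_right volume t)

theorem coeFn_shiftL (t : ℝ) (h : Lp E 2 (volume : Measure ℝ)) :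
    shiftL t h =ᵐ[volume] fun x => h (x - t) :=
  Lp.coeFn_compMeasurePreserving h (measurePreserving_sub_right volume t)

theorem shiftL_shiftL (s t : ℝ) (h : Lp E 2 (volume : Measure ℝ)) :
    shiftL s (shiftL t h) = shiftL (s + t) h := by
  ext1
  filter_upwards [coeFn_shiftL s (shiftL t h), coeFn_shiftL (s + t) h,
    (measurePreserving_sub_right volume s).quasiMeasurePreserving.ae (coeFn_shiftL t h)]
    with x h1 h2 h3
  rw [h1, h2, h3]
  congr 1
  ring

theorem shiftL_zero (h : Lp E 2 (volume : Measure ℝ)) : shiftL 0 h = h := by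
  ext1
  filter_upwards [coeFn_shiftL 0 h] with x h1
  rw [h1, sub_zero]

theorem scaleL_scaleL {a b : ℝ} (ha : a ≠ 0) (hb : b ≠ 0) (h : Lp E 2 (volume : Measure ℝ)) :
    scaleL ha (scaleL hb h) = scaleL (mul_ne_zero ha hb) h := by
  ext1
  filter_upwards [coeFn_scaleL ha (scaleL hb h), coeFn_scaleL (mul_ne_zero ha hb) h,
    (quasiMeasurePreserving_mul_left ha).ae (coeFn_scaleL hb h)] with x h1 h2 h3
  rw [h1, h2, h3]
  congr 1
  ring

theorem shiftL_scaleL {a : ℝ} (ha : a ≠ 0) (t : ℝ) (h : Lp E 2 (volume : Measure ℝ)) :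
    shiftL t (scaleL ha h) = scaleL ha (shiftL (a * t) h) := by
  ext1
  filter_upwards [coeFn_shiftL t (scaleL ha h), coeFn_scaleL ha (shiftL (a * t) h),
    (measurePreserving_sub_right volume t).quasiMeasurePreserving.ae (coeFn_scaleL ha h),
    (quasiMeasurePreserving_mul_left ha).ae (coeFn_shiftL (a * t) h)] with x h1 h2 h3 h4
  rw [h1, h2, h3, h4]
  congr 1
  ring

end Generic

variable {r : ℕ}

theorem translate_eq_shiftL (t : ℝ) (h : VecL2 r) : translate t h = shiftL t h := rfl

theorem dilate_eq_scaleL (j : ℤ) (h : VecL2 r) :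
    dilate j h = scaleL (zpow_ne_zero j (two_ne_zero (α := ℝ))) h := rfl

theorem dilate_dilate (i j : ℤ) (h : VecL2 r) : dilate i (dilate j h) = dilate (i + j) h := by
  simp only [dilate_eq_scaleL, scaleL_scaleL]
  congr 2
  rw [zpow_add₀ two_ne_zero]

theorem dilate_zero (h : VecL2 r) : dilate 0 h = h := by
  ext1
  filter_upwards [coeFn_scaleL (zpow_ne_zero 0 (two_ne_zero (α := ℝ))) h] with x hx
  rw [dilate_eq_scaleL, hx, zpow_zero, one_mul]

/-- The dilation `h ↦ h(2^j ·)` as a continuous linear automorphism of `L_2^r(ℝ)`. -/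
def dilateEquiv (j : ℤ) : VecL2 r ≃L[ℝ] VecL2 r :=
  ContinuousLinearEquiv.equivOfInverse (scaleL (zpow_ne_zero j (two_ne_zero (α := ℝ))))
    (scaleL (zpow_ne_zero (-j) (two_ne_zero (α := ℝ))))
    (fun h => by
      rw [← dilate_eq_scaleL, ← dilate_eq_scaleL, dilate_dilate, neg_add_cancel, dilate_zero])
    (fun h => by
      rw [← dilate_eq_scaleL, ← dilate_eq_scaleL, dilate_dilate, add_neg_cancel, dilate_zero])

theorem dilateEquiv_apply (j : ℤ) (h : VecL2 r) : dilateEquiv j h = dilate j h := rfl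

theorem enorm_dilate_sq (j : ℤ) (h : VecL2 r) :
    ‖dilate j h‖ₑ ^ 2 = ENNReal.ofReal ((2 : ℝ) ^ (-j)) * ‖h‖ₑ ^ 2 := by
  rw [dilate_eq_scaleL, enorm_scaleL_sq, ← zpow_neg, abs_of_pos (by positivity)]

theorem translate_dilate (t : ℝ) (j : ℤ) (h : VecL2 r) :
    translate t (dilate j h) = dilate j (translate ((2 : ℝ) ^ j * t) h) :=
  shiftL_scaleL (zpow_ne_zero j two_ne_zero) t h

theorem translate_translate (s t : ℝ) (h : VecL2 r) :
    translate s (translate t h) = translate (s + t) h := shiftL_shiftL s t h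

end

/-! ### Sums over the integers and periodization -/

/-- The Cauchy–Schwarz inequality for series in `[0, ∞]`. -/
theorem ENNReal_tsum_mul_sq_le {ι : Type*} [Countable ι] (a b : ι → ENNReal) :
    (∑' i, a i * b i) ^ 2 ≤ (∑' i, a i ^ 2) * ∑' i, b i ^ 2 := by
  let _ : MeasurableSpace ι := ⊤
  have h := ENNReal.lintegral_mul_le_Lp_mul_Lq (Measure.count : Measure ι)
    (p := 2) (q := 2) ⟨by norm_num, by norm_num, by norm_num⟩ (f := a) (g := b)
    (Measurable.of_discrete.aemeasurable) (Measurable.of_discrete.aemeasurable)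
  simp only [lintegral_count, Pi.mul_apply] at h
  calc (∑' i, a i * b i) ^ 2 ≤ _ := pow_le_pow_left' h 2
    _ = _ := by
      rw [mul_pow, ← ENNReal.rpow_natCast, ← ENNReal.rpow_natCast, ← ENNReal.rpow_mul,
        ← ENNReal.rpow_mul]
      norm_num

/-- The integral over the line is the integral over a period of the periodization. -/
theorem lintegral_eq_lintegral_Ioc_tsum (t : ℝ) {f : ℝ → ENNReal} (hf : AEMeasurable f) :
    ∫⁻ x, f x = ∫⁻ x in Set.Ioc t (t + 1), ∑' k : ℤ, f (x + k) := by
  have hk : ∀ k : ℤ, AEMeasurable (fun x : ℝ => f (x + k)) volume := fun k =>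
    hf.comp_quasiMeasurePreserving
      (measurePreserving_add_right volume (k : ℝ)).quasiMeasurePreserving
  rw [lintegral_tsum fun k => (hk k).restrict, ← setLIntegral_univ, ← iUnion_Ioc_add_intCast t,
    lintegral_iUnion (fun _ => measurableSet_Ioc) (Set.pairwise_disjoint_Ioc_add_intCast t)]
  refine tsum_congr fun k => ?_
  rw [← (measurePreserving_add_right volume (k : ℝ)).setLIntegral_comp_preimage_emb
    (measurableEmbedding_addRight _)]
  congr 2
  ext x
  simp only [Set.mem_preimage, Set.mem_Ioc]
  constructor <;> rintro ⟨h1, h2⟩ <;> constructor <;> linarith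

/-! ### The spaces `V_j` -/

section

variable {r : ℕ} {F : ℝ → Matrix (Fin r) (Fin r) ℝ} {hF : IsMatL2 F}

theorem translateMulVec_add (k : ℤ) (v w : Fin r → ℝ) :
    translateMulVec F hF k (v + w) = translateMulVec F hF k v + translateMulVec F hF k w := by
  simp [translateMulVec, add_smul, Finset.sum_add_distrib]

theorem translateMulVec_smul (k : ℤ) (a : ℝ) (v : Fin r → ℝ) :
    translateMulVec F hF k (a • v) = a • translateMulVec F hF k v := by
  simp [translateMulVec, Finset.smul_sum, mul_smul]

theorem translateMulVec_zero (k : ℤ) : translateMulVec F hF k 0 = 0 := by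
  simp [translateMulVec]

theorem translateMulVec_single (k : ℤ) (i : Fin r) (a : ℝ) :
    translateMulVec F hF k (Pi.single i a) = a • translate (k : ℝ) (column F hF i) := by
  rw [translateMulVec, Finset.sum_eq_single i]
  · simp
  · intro j _ hj
    simp [hj]
  · simp

theorem translate_translateMulVec (m k : ℤ) (v : Fin r → ℝ) :
    translate (m : ℝ) (translateMulVec F hF k v) = translateMulVec F hF (m + k) v := by
  simp only [translateMulVec, translate_eq_shiftL, map_sum, map_smul, shiftL_shiftL]
  push_cast
  rfl

/-- For stable `F`, the convolution `c ↦ F * c` as a bounded operator. -/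
def convL (hs : IsStable F hF) : VecSeq2 r →L[ℝ] VecL2 r :=
  LinearMap.mkContinuous
    { toFun := conv F hF
      map_add' := fun c d => by
        obtain ⟨K₁, K₂, -, -, h⟩ := hs
        rw [conv, conv, conv, ← (h c).1.tsum_add (h d).1]
        exact tsum_congr fun k => by rw [← translateMulVec_add]; rfl
      map_smul' := fun a c => by
        obtain ⟨K₁, K₂, -, -, h⟩ := hs
        rw [RingHom.id_apply, conv, conv, ← (h c).1.tsum_const_smul a]
        exact tsum_congr fun k => by rw [← translateMulVec_smul]; rfl }
    hs.choose_spec.choose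
    (fun c => (hs.choose_spec.choose_spec.2.2 c).2.2)

/-- The space `V_0` as a submodule. -/
def baseSpace (hs : IsStable F hF) : Submodule ℝ (VecL2 r) := LinearMap.range (convL hs).toLinearMap

theorem mem_baseSpace {hs : IsStable F hF} {h : VecL2 r} :
    h ∈ baseSpace hs ↔ ∃ c, conv F hF c = h := Iff.rfl

/-- The lower stability bound makes the range of `c ↦ F * c` closed. -/
theorem isClosed_baseSpace (hs : IsStable F hF) : IsClosed (baseSpace hs : Set (VecL2 r)) := by
  obtain ⟨K₁, K₂, h1, h2, h⟩ := id hs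
  have hanti : AntilipschitzWith (K₁⁻¹).toNNReal (convL hs) := by
    refine AddMonoidHomClass.antilipschitz_of_bound (convL hs) fun c => ?_
    rw [Real.coe_toNNReal _ (by positivity), inv_mul_eq_div, le_div_iff₀ h1, mul_comm]
    exact (h c).2.1
  exact hanti.isClosed_range (convL hs).uniformContinuous

theorem translateMulVec_mem_baseSpace (hs : IsStable F hF) (k : ℤ) (v : Fin r → ℝ) :
    translateMulVec F hF k v ∈ baseSpace hs := by
  refine ⟨lp.single 2 k (WithLp.toLp 2 v), ?_⟩
  change conv F hF _ = _
  rw [conv, tsum_eq_single k]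
  · simp
  · intro j hj
    rw [lp.single_apply_ne _ _ _ hj]
    exact translateMulVec_zero j

theorem baseSpace_le {hs : IsStable F hF} {W : Submodule ℝ (VecL2 r)}
    (hW : IsClosed (W : Set (VecL2 r))) (h : ∀ k v, translateMulVec F hF k v ∈ W) :
    baseSpace hs ≤ W := by
  rintro _ ⟨c, rfl⟩
  exact hW.mem_of_tendsto (hs.choose_spec.choose_spec.2.2 c).1.hasSum
    (Filter.Eventually.of_forall fun s => sum_mem fun k _ => h k (c k))

theorem translate_mem_baseSpace {hs : IsStable F hF} (m : ℤ) {h : VecL2 r}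
    (hh : h ∈ baseSpace hs) : translate (m : ℝ) h ∈ baseSpace hs := by
  have : baseSpace hs ≤ (baseSpace hs).comap (shiftL (E := EuclideanSpace ℝ (Fin r))
      (m : ℝ)).toLinearMap := by
    refine baseSpace_le ((isClosed_baseSpace hs).preimage (shiftL (m : ℝ)).continuous)
      fun k v => ?_
    change translate (m : ℝ) _ ∈ baseSpace hs
    rw [translate_translateMulVec]
    exact translateMulVec_mem_baseSpace hs _ _
  exact this hh

theorem translate_mem_baseSpace_iff {hs : IsStable F hF} (m : ℤ) {h : VecL2 r} :
    translate (m : ℝ) h ∈ baseSpace hs ↔ h ∈ baseSpace hs := by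
  refine ⟨fun hh => ?_, translate_mem_baseSpace m⟩
  have := translate_mem_baseSpace (-m) hh
  rw [translate_translate, Int.cast_neg, neg_add_cancel, translate_eq_shiftL, shiftL_zero] at this
  exact this

/-- The space `V_j` as a submodule. -/
def scaleSubmodule (hs : IsStable F hF) (j : ℤ) : Submodule ℝ (VecL2 r) :=
  (baseSpace hs).map (dilateEquiv j).toLinearMap

theorem coe_scaleSubmodule (hs : IsStable F hF) (j : ℤ) :
    (scaleSubmodule hs j : Set (VecL2 r)) = scaleSpace F hF j := by
  ext h
  constructor
  · rintro ⟨_, ⟨c, rfl⟩, rfl⟩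
    exact ⟨c, rfl⟩
  · rintro ⟨c, rfl⟩
    exact ⟨_, ⟨c, rfl⟩, rfl⟩

theorem dilate_mem_scaleSubmodule {hs : IsStable F hF} {j : ℤ} {h : VecL2 r} :
    dilate j h ∈ scaleSubmodule hs j ↔ h ∈ baseSpace hs := by
  constructor
  · rintro ⟨g, hg, hgh⟩
    rwa [← (dilateEquiv j).injective hgh]
  · exact fun hh => ⟨h, hh, rfl⟩

theorem mem_scaleSubmodule {hs : IsStable F hF} {j : ℤ} {h : VecL2 r} :
    h ∈ scaleSubmodule hs j ↔ dilate (-j) h ∈ baseSpace hs := by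
  rw [← dilate_mem_scaleSubmodule (j := j), dilate_dilate, add_neg_cancel, dilate_zero]

theorem isClosed_scaleSubmodule (hs : IsStable F hF) (j : ℤ) :
    IsClosed (scaleSubmodule hs j : Set (VecL2 r)) :=
  (dilateEquiv j).toHomeomorph.isClosedMap _ (isClosed_baseSpace hs)

theorem baseSpace_le_scaleSubmodule_one (hs : IsStable F hF) {A : ℤ → Matrix (Fin r) (Fin r) ℝ}
    (href : IsRefinable F hF A) : baseSpace hs ≤ scaleSubmodule hs 1 := by
  obtain ⟨G, hG⟩ := href
  refine baseSpace_le (isClosed_scaleSubmodule hs 1) fun k v => ?_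
  refine sum_mem fun i _ => Submodule.smul_mem _ _ ?_
  rw [(hG i).2, translate_dilate, dilate_mem_scaleSubmodule]
  have : ((2 : ℝ) ^ (1 : ℤ) * (k : ℝ)) = ((2 * k : ℤ) : ℝ) := by push_cast; norm_num
  rw [this, translate_mem_baseSpace_iff]
  exact (isClosed_baseSpace hs).mem_of_tendsto (hG i).1
    (Filter.Eventually.of_forall fun s => sum_mem fun k _ => translateMulVec_mem_baseSpace hs _ _)

theorem scaleSubmodule_le_succ (hs : IsStable F hF) {A : ℤ → Matrix (Fin r) (Fin r) ℝ}
    (href : IsRefinable F hF A) (j : ℤ) : scaleSubmodule hs j ≤ scaleSubmodule hs (j + 1) := by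
  intro h hh
  rw [mem_scaleSubmodule] at hh ⊢
  have := baseSpace_le_scaleSubmodule_one hs href hh
  rwa [mem_scaleSubmodule, dilate_dilate, ← neg_add_rev] at this

theorem translate_mem_scaleSubmodule_iff (hs : IsStable F hF) (j k : ℤ) (h : VecL2 r) :
    h ∈ scaleSubmodule hs j ↔
      translate (-((2 : ℝ) ^ (-j) * (k : ℝ))) h ∈ scaleSubmodule hs j := by
  obtain ⟨g, rfl⟩ := (dilateEquiv j).surjective h
  rw [dilateEquiv_apply, translate_dilate, dilate_mem_scaleSubmodule, dilate_mem_scaleSubmodule]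
  have : (2 : ℝ) ^ j * -((2 : ℝ) ^ (-j) * (k : ℝ)) = ((-k : ℤ) : ℝ) := by
    rw [mul_neg, ← mul_assoc, ← zpow_add₀ two_ne_zero]
    simp
  rw [this, translate_mem_baseSpace_iff]

theorem baseSpace_eq_closure_span (hs : IsStable F hF) :
    (baseSpace hs : Set (VecL2 r)) = closure (Submodule.span ℝ
        {h : VecL2 r | ∃ (i : Fin r) (k : ℤ), h = translate (k : ℝ) (column F hF i)}) := by
  rw [← Submodule.topologicalClosure_coe]
  congr 1
  refine le_antisymm (baseSpace_le (Submodule.isClosed_topologicalClosure _) fun k v => ?_)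
    (Submodule.topologicalClosure_minimal _ (Submodule.span_le.2 ?_) (isClosed_baseSpace hs))
  · exact Submodule.le_topologicalClosure _ (sum_mem fun i _ => Submodule.smul_mem _ _
      (Submodule.subset_span ⟨i, k, rfl⟩))
  · rintro _ ⟨i, k, rfl⟩
    have := translateMulVec_mem_baseSpace hs k (Pi.single i 1)
    rwa [translateMulVec_single, one_smul] at this

/-- Assembling `r` scalar square summable sequences into a vector sequence. -/
theorem exists_vecSeq2 (c : Fin r → ℤ → ℝ) (hc : ∀ i, Summable fun k => |c i k| ^ 2) :
    ∃ C : VecSeq2 r, (∀ k, C k = WithLp.toLp 2 fun i => c i k) ∧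
      ‖C‖ = √(∑ i, ∑' k, |c i k| ^ 2) := by
  have hterm : ∀ k : ℤ, ‖(WithLp.toLp 2 fun i => c i k : EuclideanSpace ℝ (Fin r))‖ ^ 2 =
      ∑ i, |c i k| ^ 2 := fun k => by
    rw [EuclideanSpace.norm_sq_eq]
    rfl
  have hsum : Summable fun k : ℤ => ∑ i, |c i k| ^ 2 := summable_sum fun i _ => hc i
  have hmem : Memℓp (fun k : ℤ => (WithLp.toLp 2 fun i => c i k : EuclideanSpace ℝ (Fin r))) 2 := by
    refine memℓp_gen ?_
    simpa [hterm] using hsum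
  refine ⟨⟨_, hmem⟩, fun k => rfl, ?_⟩
  have h := lp.norm_rpow_eq_tsum (p := 2) (by norm_num) (⟨_, hmem⟩ : VecSeq2 r)
  simp only [ENNReal.toReal_ofNat, Real.rpow_ofNat, hterm] at h
  rw [← Summable.tsum_finsetSum fun i _ => hc i, ← h, Real.sqrt_sq (norm_nonneg _)]

theorem jointlyStable_column (hs : IsStable F hF) : JointlyStable (column F hF) := by
  obtain ⟨K₁, K₂, h1, h2, h⟩ := hs
  refine ⟨K₁, K₂, h1, h2, fun c hc => ?_⟩
  have hsum : ∀ i, Summable fun k : ℤ => c i k • translate (k : ℝ) (column F hF i) := fun i => by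
    obtain ⟨C, hC, -⟩ := exists_vecSeq2 (fun j k => if j = i then c i k else 0) (fun j => by
      by_cases hj : j = i
      · simpa [hj] using hc i
      · simp [hj])
    refine (h C).1.congr fun k => ?_
    rw [hC, ← translateMulVec_single]
    congr 1
    ext j
    simp [Pi.single_apply]
  obtain ⟨C, hC, hn⟩ := exists_vecSeq2 c hc
  refine ⟨hsum, ?_⟩
  have hconv : ∑ i, ∑' k : ℤ, c i k • translate (k : ℝ) (column F hF i) = conv F hF C := by
    rw [conv, ← Summable.tsum_finsetSum fun i _ => hsum i]
    exact tsum_congr fun k => by rw [hC, translateMulVec]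
  rw [hconv, ← hn]
  exact (h C).2

end

/-! ### The intersection of the `V_j` -/

section

variable {r : ℕ} {F : ℝ → Matrix (Fin r) (Fin r) ℝ} {hF : IsMatL2 F}

theorem enorm_vecSeq2_sq (c : VecSeq2 r) : ‖c‖ₑ ^ 2 = ∑' k, ‖c k‖ₑ ^ 2 := by
  have h := lp.norm_rpow_eq_tsum (p := 2) (by norm_num) c
  have hs := (lp.memℓp c).summable (by norm_num)
  simp only [ENNReal.toReal_ofNat, Real.rpow_ofNat] at h hs
  rw [← ofReal_norm, ← ENNReal.ofReal_pow (norm_nonneg _), h,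
    ENNReal.ofReal_tsum_of_nonneg (fun _ => by positivity) hs]
  exact tsum_congr fun k => by rw [ENNReal.ofReal_pow (norm_nonneg _), ofReal_norm]

/-- `∑ i, ∑ k, |f^i(x + k)|²`, a function of period one. -/
def columnSquareSum (F : ℝ → Matrix (Fin r) (Fin r) ℝ) (hF : IsMatL2 F) (x : ℝ) : ENNReal :=
  ∑ i, ∑' k : ℤ, ‖column F hF i (x + k)‖ₑ ^ 2

theorem lintegral_columnSquareSum_ne_top (t : ℝ) :
    ∫⁻ x in Set.Ioc t (t + 1), columnSquareSum F hF x ≠ ⊤ := by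
  have hmeas : ∀ i, AEMeasurable (fun x => ‖column F hF i x‖ₑ ^ 2) volume := fun i =>
    ((Lp.aestronglyMeasurable _).enorm).pow_const _
  have hk : ∀ i (k : ℤ), AEMeasurable (fun x : ℝ => ‖column F hF i (x + k)‖ₑ ^ 2) volume :=
    fun i k => (hmeas i).comp_quasiMeasurePreserving
      (measurePreserving_add_right volume (k : ℝ)).quasiMeasurePreserving
  simp only [columnSquareSum]
  rw [lintegral_finsetSum' _ fun i _ => (AEMeasurable.tsum fun k => hk i k).restrict]
  refine (ENNReal.sum_lt_top.2 fun i _ => ?_).ne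
  rw [← lintegral_eq_lintegral_Ioc_tsum t (hmeas i), ← enorm_sq_eq_lintegral]
  exact ENNReal.pow_lt_top enorm_lt_top

/-- On a set `s`, the energy of `F * c` is at most `‖c‖²` times that of the periodized columns. -/
theorem setLIntegral_conv_sq_le (hs : IsStable F hF) (c : VecSeq2 r) (s : Set ℝ) :
    ∫⁻ x in s, ‖conv F hF c x‖ₑ ^ 2 ≤
      ‖c‖ₑ ^ 2 * (r * ∫⁻ x in s, columnSquareSum F hF x) := by
  set R := LpToLpRestrictCLM ℝ (EuclideanSpace ℝ (Fin r)) ℝ volume 2 s with hR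
  have hRn : ∀ h : VecL2 r, ‖R h‖ₑ ^ 2 = ∫⁻ x in s, ‖h x‖ₑ ^ 2 := fun h => by
    rw [enorm_sq_eq_lintegral]
    refine lintegral_congr_ae ?_
    filter_upwards [LpToLpRestrictCLM_coeFn ℝ s h] with x hx
    rw [hx]
  rw [← hRn, conv, R.map_tsum (hs.choose_spec.choose_spec.2.2 c).1]
  have hterm : ∀ k : ℤ, ‖R (translateMulVec F hF k (c k))‖ₑ ≤
      ‖c k‖ₑ * ∑ i, ‖R (translate (k : ℝ) (column F hF i))‖ₑ := fun k => by
    rw [translateMulVec, map_sum, Finset.mul_sum]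
    refine (enorm_sum_le _ _).trans (Finset.sum_le_sum fun i _ => ?_)
    rw [map_smul, enorm_smul]
    gcongr
    exact enorm_le_iff_norm_le.2 (PiLp.norm_apply_le (c k) i)
  have hmeas : ∀ i (k : ℤ), AEMeasurable (fun x : ℝ => ‖column F hF i (x + k)‖ₑ ^ 2) volume :=
    fun i k => (((Lp.aestronglyMeasurable _).enorm).pow_const _).comp_quasiMeasurePreserving
      (measurePreserving_add_right volume (k : ℝ)).quasiMeasurePreserving
  calc _ ≤ (∑' k : ℤ, ‖c k‖ₑ * ∑ i, ‖R (translate (k : ℝ) (column F hF i))‖ₑ) ^ 2 := by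
        gcongr
        exact (enorm_tsum_le_tsum_enorm).trans (ENNReal.tsum_le_tsum hterm)
    _ ≤ (∑' k : ℤ, ‖c k‖ₑ ^ 2) *
          ∑' k : ℤ, (∑ i, ‖R (translate (k : ℝ) (column F hF i))‖ₑ) ^ 2 :=
        ENNReal_tsum_mul_sq_le _ _
    _ ≤ (∑' k : ℤ, ‖c k‖ₑ ^ 2) *
          ∑' k : ℤ, r * ∑ i, ‖R (translate (k : ℝ) (column F hF i))‖ₑ ^ 2 := by
        gcongr with k
        simpa using ENNReal_tsum_mul_sq_le (fun _ : Fin r => 1)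
          fun i => ‖R (translate (k : ℝ) (column F hF i))‖ₑ
    _ = _ := by
        rw [← enorm_vecSeq2_sq, ENNReal.tsum_mul_left, Summable.tsum_finsetSum
          fun _ _ => ENNReal.summable]
        congr 2
        simp only [columnSquareSum]
        rw [lintegral_finsetSum' _ fun i _ =>
          (AEMeasurable.tsum fun k => hmeas i k).restrict]
        refine Finset.sum_congr rfl fun i _ => ?_
        rw [lintegral_tsum fun k => (hmeas i k).restrict, ← (Equiv.neg ℤ).tsum_eq]
        refine tsum_congr fun k => ?_
        rw [hRn]
        refine lintegral_congr_ae (ae_restrict_of_ae ?_)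
        filter_upwards [coeFn_shiftL ((-k : ℤ) : ℝ) (column F hF i)] with x hx
        rw [Equiv.neg_apply, translate_eq_shiftL, hx, Int.cast_neg, sub_neg_eq_add]

/-- If `h` lies in `V_{-n}`, then `h(2^n ·) = F * c` with `‖c‖² ≲ 2^{-n} ‖h‖²`, so that the energy of
`h` on `[-N, N]` is at most a constant times the energy of the periodized columns on
`[-2^{-n} N, 2^{-n} N]`, which tends to zero as `n → ∞`. -/
theorem eq_zero_of_forall_mem_scaleSubmodule (hs : IsStable F hF) {h : VecL2 r}
    (hh : ∀ j, h ∈ scaleSubmodule hs j) : h = 0 := by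
  obtain ⟨K₁, K₂, h1, h2, hK⟩ := id hs
  have hloc : ∀ N : ℕ, ∫⁻ x in Set.Ioc (-(N : ℝ)) N, ‖h x‖ₑ ^ 2 = 0 := by
    intro N
    set C : ENNReal := ENNReal.ofReal (K₁⁻¹ ^ 2) * ‖h‖ₑ ^ 2 * r with hC
    have hCtop : C ≠ ⊤ := by finiteness
    set s : ℕ → Set ℝ := fun n => Set.Ioc (-(N * (2 : ℝ)⁻¹ ^ n)) (N * (2 : ℝ)⁻¹ ^ n) with hsdef
    have hle : ∀ n : ℕ, ∫⁻ x in Set.Ioc (-(N : ℝ)) N, ‖h x‖ₑ ^ 2 ≤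
        C * ∫⁻ x in s n, columnSquareSum F hF x := by
      intro n
      obtain ⟨c, hc⟩ := mem_baseSpace.1 (mem_scaleSubmodule.1 (hh (-n)))
      rw [neg_neg] at hc
      have hcn : ‖c‖ₑ ^ 2 ≤ ENNReal.ofReal (K₁⁻¹ ^ 2) * (ENNReal.ofReal ((2 : ℝ) ^ (-(n : ℤ))) *
          ‖h‖ₑ ^ 2) := by
        rw [← enorm_dilate_sq, ← hc, ← ofReal_norm, ← ofReal_norm,
          ← ENNReal.ofReal_pow (by positivity), ← ENNReal.ofReal_pow (by positivity),
          ← ENNReal.ofReal_mul (by positivity), ← mul_pow]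
        gcongr
        rw [inv_mul_eq_div, le_div_iff₀ h1, mul_comm]
        exact (hK c).2.1
      have hpos : (2 : ℝ) ^ n ≠ 0 := by positivity
      have hchange : ∫⁻ x in s n, ‖conv F hF c x‖ₑ ^ 2 =
          ENNReal.ofReal ((2 : ℝ) ^ (-(n : ℤ))) * ∫⁻ x in Set.Ioc (-(N : ℝ)) N, ‖h x‖ₑ ^ 2 := by
        rw [← lintegral_indicator measurableSet_Ioc, ← lintegral_indicator measurableSet_Ioc]
        have := lintegral_comp_mul_left
          ((Set.Ioc (-(N : ℝ)) N).indicator fun x => ‖h x‖ₑ ^ 2) hpos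
        rw [zpow_neg, zpow_natCast, ← abs_of_pos (show (0 : ℝ) < (2 ^ n)⁻¹ by positivity), ← this]
        refine lintegral_congr_ae ?_
        filter_upwards [coeFn_scaleL (zpow_ne_zero (n : ℤ) (two_ne_zero (α := ℝ))) h] with x hx
        rw [hc, dilate_eq_scaleL]
        have hiff : x ∈ s n ↔ 2 ^ n * x ∈ Set.Ioc (-(N : ℝ)) N := by
          rw [hsdef, Set.mem_Ioc, Set.mem_Ioc, inv_pow, ← div_eq_mul_inv, ← neg_div,
            div_lt_iff₀ (by positivity), le_div_iff₀ (by positivity), mul_comm x]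
        by_cases hx' : x ∈ s n
        · rw [Set.indicator_of_mem hx', Set.indicator_of_mem (hiff.1 hx'), hx, zpow_natCast]
        · rw [Set.indicator_of_notMem hx', Set.indicator_of_notMem (mt hiff.2 hx')]
      have h3 := setLIntegral_conv_sq_le hs c (s n)
      rw [hchange] at h3
      have hp0 : ENNReal.ofReal ((2 : ℝ) ^ (-(n : ℤ))) ≠ 0 := by
        rw [Ne, ENNReal.ofReal_eq_zero, not_le]
        positivity
      refine (ENNReal.mul_le_mul_iff_right hp0 ENNReal.ofReal_ne_top).1
        (h3.trans ((mul_le_mul_left hcn _).trans (le_of_eq ?_)))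
      rw [hC]
      ring
    -- for large `n` the interval `s n` lies in a single period, where the periodization is integrable
    have hlim : Filter.Tendsto (fun n => C * ∫⁻ x in s n, columnSquareSum F hF x)
        Filter.atTop (nhds 0) := by
      have hsmall : Filter.Tendsto (fun n : ℕ => (N : ℝ) * (2 : ℝ)⁻¹ ^ n) Filter.atTop
          (nhds 0) := by
        simpa using (tendsto_pow_atTop_nhds_zero_of_lt_one (r := (2 : ℝ)⁻¹)
          (by norm_num) (by norm_num)).const_mul (N : ℝ)
      have hvol : Filter.Tendsto (volume.restrict (Set.Ioc (-(1 / 2) : ℝ) (-(1 / 2) + 1)) ∘ s)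
          Filter.atTop (nhds 0) := by
        refine tendsto_of_tendsto_of_tendsto_of_le_of_le (h := fun n => volume (s n))
          tendsto_const_nhds ?_ (fun _ => bot_le) (fun n => Measure.restrict_apply_le _ _)
        have : Filter.Tendsto (fun n : ℕ => ENNReal.ofReal ((N : ℝ) * (2 : ℝ)⁻¹ ^ n * 2))
            Filter.atTop (nhds 0) := by
          simpa using ENNReal.tendsto_ofReal (hsmall.mul_const 2)
        refine this.congr fun n => ?_
        rw [hsdef, Real.volume_Ioc]
        congr 1
        ring
      have h4 := tendsto_setLIntegral_zero (lintegral_columnSquareSum_ne_top (hF := hF)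
        (-(1 / 2))) hvol
      have h5 := ENNReal.Tendsto.const_mul h4 (Or.inr hCtop)
      rw [mul_zero] at h5
      refine h5.congr' ?_
      filter_upwards [hsmall.eventually (gt_mem_nhds (show (0 : ℝ) < 1 / 2 by norm_num))] with n hn
      rw [Measure.restrict_restrict measurableSet_Ioc, Set.inter_eq_left.2]
      intro x hx
      simp only [Set.mem_Ioc] at hx ⊢
      constructor <;> linarith [hx.1, hx.2]
    exact le_antisymm (ge_of_tendsto' hlim hle) bot_le
  have hae : ∀ N : ℕ, ∀ᵐ x : ℝ, x ∈ Set.Ioc (-(N : ℝ)) N → h x = 0 := fun N => by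
    have h6 := (lintegral_eq_zero_iff' (((Lp.aestronglyMeasurable h).enorm.pow_const 2).restrict)).1
      (hloc N)
    rw [← ae_restrict_iff' measurableSet_Ioc]
    filter_upwards [h6] with x hx
    simpa using hx
  ext1
  filter_upwards [ae_all_iff.2 hae, Lp.coeFn_zero (EuclideanSpace ℝ (Fin r)) 2
    (volume : Measure ℝ)] with x hx h0
  obtain ⟨N, hN⟩ := exists_nat_gt |x|
  rw [h0]
  exact hx N ⟨(abs_lt.1 hN).1, (abs_lt.1 hN).2.le⟩

end

/-! ### The Fourier transform of translates and dilates -/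

section FourierL2

open FourierTransform SchwartzMap

section Modulation

variable {E : Type*} [NormedAddCommGroup E] [InnerProductSpace ℂ E]

theorem memLp_fourierChar_smul (t : ℝ) (h : Lp E 2 (volume : Measure ℝ)) :
    MemLp (fun x => Real.fourierChar (t * x) • h x) 2 (volume : Measure ℝ) :=
  (Lp.memLp h).congr_norm
    (((by fun_prop : Continuous fun x : ℝ => Real.fourierChar (t * x)).aestronglyMeasurable).smul
      (Lp.aestronglyMeasurable h)) (by simp)

/-- Multiplication by the character `x ↦ e^{2πitx}` on `L²(ℝ; E)`. -/
def modL (t : ℝ) : Lp E 2 (volume : Measure ℝ) →ₗᵢ[ℝ] Lp E 2 (volume : Measure ℝ) where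
  toFun h := (memLp_fourierChar_smul t h).toLp _
  map_add' f g := by
    rw [← MemLp.toLp_add]
    refine (MemLp.toLp_eq_toLp_iff _ _).2 ?_
    filter_upwards [Lp.coeFn_add f g] with x hx
    rw [hx]
    simp
  map_smul' c f := by
    rw [RingHom.id_apply, ← MemLp.toLp_const_smul]
    refine (MemLp.toLp_eq_toLp_iff _ _).2 ?_
    filter_upwards [Lp.coeFn_smul c f] with x hx
    rw [hx, Pi.smul_apply, Pi.smul_apply]
    exact smul_comm _ _ _
  norm_map' f := by
    simp only [LinearMap.coe_mk, AddHom.coe_mk]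
    rw [Lp.norm_toLp, Lp.norm_def]
    congr 1
    exact eLpNorm_congr_norm_ae (by simp)

theorem coeFn_modL (t : ℝ) (h : Lp E 2 (volume : Measure ℝ)) :
    modL t h =ᵐ[volume] fun x => Real.fourierChar (t * x) • h x :=
  (memLp_fourierChar_smul t h).coeFn_toLp

end Modulation

variable {E : Type*} [NormedAddCommGroup E] [InnerProductSpace ℂ E] [CompleteSpace E]

theorem fourier_shiftL (t : ℝ) (f : Lp E 2 (volume : Measure ℝ)) :
    𝓕 (shiftL t f) = modL (-t) (𝓕 f) := by
  have hc : Continuous (fun f : Lp E 2 (volume : Measure ℝ) => 𝓕 f) :=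
    (Lp.fourierTransformₗᵢ ℝ E).continuous
  refine DenseRange.induction_on (p := fun f => 𝓕 (shiftL t f) = modL (-t) (𝓕 f))
    (SchwartzMap.denseRange_toLpCLM (p := 2) ENNReal.ofNat_ne_top) f
    (isClosed_eq (hc.comp (shiftL t).continuous) ((modL (-t)).continuous.comp hc)) fun g => ?_
  have h1 : shiftL t (g.toLp 2) = (SchwartzMap.compSubConstCLM ℂ t g).toLp 2 := by
    ext1
    filter_upwards [coeFn_shiftL t (g.toLp 2), SchwartzMap.coeFn_toLp
      (SchwartzMap.compSubConstCLM ℂ t g) 2 volume, (measurePreserving_sub_right volume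
      t).quasiMeasurePreserving.ae (SchwartzMap.coeFn_toLp g 2 volume)] with x h1 h2 h3
    rw [h1, h2, h3]
    rfl
  change 𝓕 (shiftL t (g.toLp 2)) = modL (-t) (𝓕 (g.toLp 2))
  rw [h1, SchwartzMap.toLp_fourier_eq, SchwartzMap.toLp_fourier_eq]
  ext1
  filter_upwards [SchwartzMap.coeFn_toLp (𝓕 (SchwartzMap.compSubConstCLM ℂ t g)) 2 volume,
    coeFn_modL (-t) ((𝓕 g).toLp 2), SchwartzMap.coeFn_toLp (𝓕 g) 2 volume] with x h1 h2 h3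
  rw [h1, h2, h3, SchwartzMap.fourier_coe, SchwartzMap.fourier_coe, Real.fourier_real_eq,
    Real.fourier_real_eq, ← integral_add_right_eq_self _ t, Circle.smul_def, ← integral_smul]
  refine integral_congr_ae (Filter.Eventually.of_forall fun y => ?_)
  simp only [SchwartzMap.compSubConstCLM_apply, add_sub_cancel_right]
  rw [← Circle.smul_def, smul_smul, ← AddChar.map_add_eq_mul]
  congr 2
  ring

theorem fourier_scaleL {a : ℝ} (ha : a ≠ 0) (f : Lp E 2 (volume : Measure ℝ)) :
    𝓕 (scaleL ha f) = |a⁻¹| • scaleL (inv_ne_zero ha) (𝓕 f) := by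
  have hc : Continuous (fun f : Lp E 2 (volume : Measure ℝ) => 𝓕 f) :=
    (Lp.fourierTransformₗᵢ ℝ E).continuous
  refine DenseRange.induction_on
    (p := fun f => 𝓕 (scaleL ha f) = |a⁻¹| • scaleL (inv_ne_zero ha) (𝓕 f))
    (SchwartzMap.denseRange_toLpCLM (p := 2) ENNReal.ofNat_ne_top) f
    (isClosed_eq (hc.comp (scaleL ha).continuous)
      (((scaleL (inv_ne_zero ha)).continuous.comp hc).const_smul |a⁻¹|)) fun g => ?_
  set g' := SchwartzMap.compCLMOfContinuousLinearEquiv ℂ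
    (ContinuousLinearEquiv.unitsEquivAut ℝ (Units.mk0 a ha)) g with hg'
  have hg'x : ∀ x, g' x = g (a * x) := fun x => by
    rw [hg', SchwartzMap.compCLMOfContinuousLinearEquiv_apply]
    simp [mul_comm]
  have h1 : scaleL ha (g.toLp 2) = g'.toLp 2 := by
    ext1
    filter_upwards [coeFn_scaleL ha (g.toLp 2), SchwartzMap.coeFn_toLp g' 2 volume,
      (quasiMeasurePreserving_mul_left ha).ae (SchwartzMap.coeFn_toLp g 2 volume)] with x h1 h2 h3
    rw [h1, h2, h3, hg'x]
  change 𝓕 (scaleL ha (g.toLp 2)) = |a⁻¹| • scaleL (inv_ne_zero ha) (𝓕 (g.toLp 2))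
  rw [h1, SchwartzMap.toLp_fourier_eq, SchwartzMap.toLp_fourier_eq]
  ext1
  filter_upwards [SchwartzMap.coeFn_toLp (𝓕 g') 2 volume,
    Lp.coeFn_smul |a⁻¹| (scaleL (inv_ne_zero ha) ((𝓕 g).toLp 2 volume)),
    coeFn_scaleL (inv_ne_zero ha) ((𝓕 g).toLp 2 volume),
    (quasiMeasurePreserving_mul_left (inv_ne_zero ha)).ae
      (SchwartzMap.coeFn_toLp (𝓕 g) 2 volume)] with x h1 h2 h3 h4
  rw [h1, h2, Pi.smul_apply, h3, h4, SchwartzMap.fourier_coe, SchwartzMap.fourier_coe,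
    Real.fourier_real_eq, Real.fourier_real_eq, ← Measure.integral_comp_mul_left]
  refine integral_congr_ae (Filter.Eventually.of_forall fun y => ?_)
  simp only [hg'x]
  congr 2
  field_simp

end FourierL2

/-! ### Localization by trigonometric polynomials -/

/-- The trigonometric polynomial `∑ k, p_k e^{-2πikx}`. -/
def trigPoly (p : ℤ →₀ ℂ) (x : ℝ) : ℂ :=
  p.sum fun k a => a * (Real.fourierChar (-(k : ℝ) * x) : ℂ)

theorem continuous_trigPoly (p : ℤ →₀ ℂ) : Continuous (trigPoly p) := by
  unfold trigPoly Finsupp.sum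
  fun_prop

theorem exists_trigPoly_of_mem_span {q : C(UnitAddCircle, ℂ)}
    (hq : q ∈ Submodule.span ℂ (Set.range (fourier (T := 1)))) :
    ∃ p : ℤ →₀ ℂ, ∀ x : ℝ, q (x : UnitAddCircle) = trigPoly p x := by
  obtain ⟨p, rfl⟩ := Finsupp.mem_span_range_iff_exists_finsupp.1 hq
  refine ⟨p.mapDomain (-·), fun x => ?_⟩
  rw [trigPoly, Finsupp.sum_mapDomain_index_inj neg_injective, Finsupp.sum, Finsupp.sum,
    ContinuousMap.coe_sum, Finset.sum_apply]
  refine Finset.sum_congr rfl fun k _ => ?_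
  rw [ContinuousMap.smul_apply, smul_eq_mul, fourier_coe_apply, Real.fourierChar_apply]
  congr 2
  push_cast
  ring

/-- The Parseval identity for trigonometric polynomials. -/
theorem lintegral_Ioc_trigPoly_sq (p : ℤ →₀ ℂ) :
    ∫⁻ x in Set.Ioc (0 : ℝ) (0 + 1), ‖trigPoly p x‖ₑ ^ 2 = ∑ k ∈ p.support, ‖p k‖ₑ ^ 2 := by
  set q : C(UnitAddCircle, ℂ) := ∑ k ∈ p.support, p k • fourier (-k) with hq
  have hqx : ∀ x : ℝ, q (x : UnitAddCircle) = trigPoly p x := fun x => by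
    rw [hq, trigPoly, Finsupp.sum, ContinuousMap.coe_sum, Finset.sum_apply]
    refine Finset.sum_congr rfl fun k _ => ?_
    rw [ContinuousMap.smul_apply, smul_eq_mul, fourier_coe_apply, Real.fourierChar_apply]
    congr 2
    push_cast
    ring
  have h1 := AddCircle.lintegral_preimage (T := 1) 0 fun x => ‖q x‖ₑ ^ 2
  simp only [hqx] at h1
  have hvol : (volume : Measure UnitAddCircle) = AddCircle.haarAddCircle := by
    simp [AddCircle.volume_eq_smul_haarAddCircle]
  have h2 : ContinuousMap.toLp 2 AddCircle.haarAddCircle ℂ q =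
      ∑ k ∈ p.support, p k • fourierLp (T := 1) 2 (-k) := by
    rw [hq, map_sum]
    simp only [map_smul]
  have h3 : ‖∑ k ∈ p.support, p k • fourierLp (T := 1) 2 (-k)‖ ^ 2 =
      ∑ k ∈ p.support, ‖p k‖ ^ 2 := by
    have ho : Orthonormal ℂ fun k : ℤ => fourierLp (T := 1) 2 (-k) :=
      orthonormal_fourier.comp _ neg_injective
    have := ho.inner_sum p p p.support
    rw [inner_self_eq_norm_sq_to_K] at this
    simp only [RCLike.conj_mul] at this
    exact_mod_cast this
  rw [h1, hvol]
  have h4 : ∫⁻ x, ‖q x‖ₑ ^ 2 ∂AddCircle.haarAddCircle =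
      ‖ContinuousMap.toLp 2 AddCircle.haarAddCircle ℂ q‖ₑ ^ 2 := by
    rw [enorm_sq_eq_lintegral]
    refine lintegral_congr_ae ?_
    filter_upwards [ContinuousMap.coeFn_toLp (p := 2) (𝕜 := ℂ) AddCircle.haarAddCircle q] with x hx
    rw [hx]
  rw [h4, h2, ← ofReal_norm, ← ENNReal.ofReal_pow (norm_nonneg _), h3,
    ENNReal.ofReal_sum_of_nonneg fun _ _ => by positivity]
  exact Finset.sum_congr rfl fun k _ => by rw [ENNReal.ofReal_pow (norm_nonneg _), ofReal_norm]

/-- Finite Borel measures on the circle are ordered as their integrals of `|q|²`, for `q` a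
trigonometric polynomial: these `q` are uniformly dense in the continuous functions. -/
theorem measure_le_of_forall_trigPoly {μ ν : Measure UnitAddCircle} [IsFiniteMeasure μ]
    [IsFiniteMeasure ν]
    (h : ∀ q ∈ Submodule.span ℂ (Set.range (fourier (T := 1))),
      ∫⁻ x, ‖q x‖ₑ ^ 2 ∂μ ≤ ∫⁻ x, ‖q x‖ₑ ^ 2 ∂ν) : μ ≤ ν := by
  have htoLp : ∀ (ρ : Measure UnitAddCircle) [IsFiniteMeasure ρ] (q : C(UnitAddCircle, ℂ)),
      ‖ContinuousMap.toLp 2 ρ ℂ q‖ₑ ^ 2 = ∫⁻ x, ‖q x‖ₑ ^ 2 ∂ρ := fun ρ _ q => by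
    rw [enorm_sq_eq_lintegral]
    refine lintegral_congr_ae ?_
    filter_upwards [ContinuousMap.coeFn_toLp (p := 2) (𝕜 := ℂ) ρ q] with x hx
    rw [hx]
  have hall : ∀ q : C(UnitAddCircle, ℂ), ∫⁻ x, ‖q x‖ₑ ^ 2 ∂μ ≤ ∫⁻ x, ‖q x‖ₑ ^ 2 ∂ν := by
    intro q
    rw [← htoLp, ← htoLp]
    refine pow_le_pow_left' (enorm_le_iff_norm_le.2 ?_) 2
    have hcl : IsClosed {q : C(UnitAddCircle, ℂ) |
        ‖ContinuousMap.toLp 2 μ ℂ q‖ ≤ ‖ContinuousMap.toLp 2 ν ℂ q‖} :=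
      isClosed_le (by fun_prop) (by fun_prop)
    have hq : q ∈ (Submodule.span ℂ (Set.range (fourier (T := 1)))).topologicalClosure := by
      rw [span_fourier_closure_eq_top]
      trivial
    refine closure_minimal (fun q' hq' => ?_) hcl hq
    have := h q' hq'
    rw [← htoLp, ← htoLp] at this
    exact enorm_le_iff_norm_le.1 ((ENNReal.pow_le_pow_left_iff two_ne_zero).1 this)
  have hclosed : ∀ C : Set UnitAddCircle, IsClosed C → μ C ≤ ν C := by
    intro C hC
    refine ge_of_tendsto' (HasOuterApproxClosed.tendsto_lintegral_apprSeq hC ν) fun n => ?_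
    set q : C(UnitAddCircle, ℂ) := ⟨fun x => ((hC.apprSeq n x : NNReal) : ℝ), by fun_prop⟩ with hq
    have hqx : ∀ x, ‖q x‖ₑ = hC.apprSeq n x := fun x => by
      rw [hq, ← ofReal_norm]
      simp [ENNReal.ofReal]
    calc μ C = ∫⁻ x, C.indicator 1 x ∂μ := (lintegral_indicator_one hC.measurableSet).symm
      _ ≤ ∫⁻ x, ‖q x‖ₑ ^ 2 ∂μ := by
        refine lintegral_mono (Set.indicator_le (g := fun x => ‖q x‖ₑ ^ 2) fun y hy => ?_)
        rw [hqx, HasOuterApproxClosed.apprSeq_apply_eq_one hC n hy]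
        simp
      _ ≤ ∫⁻ x, ‖q x‖ₑ ^ 2 ∂ν := hall q
      _ ≤ ∫⁻ x, hC.apprSeq n x ∂ν := by
        refine lintegral_mono fun x => ?_
        simp only [hqx]
        exact pow_le_of_le_one zero_le
          (by exact_mod_cast HasOuterApproxClosed.apprSeq_apply_le_one hC n x) two_ne_zero
  refine Measure.le_intro fun E hE _ => ?_
  rw [hE.measure_eq_iSup_isClosed_of_ne_top (measure_ne_top _ _)]
  exact iSup₂_le fun K hK => iSup_le fun hKc => (hclosed K hKc).trans (measure_mono hK)

/-- An inequality between integrals against all `|p|²`, with `p` a trigonometric polynomial of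
period one, is an almost everywhere inequality between periodizations. -/
theorem ae_tsum_le_tsum_of_forall_trigPoly {Φ₁ Φ₂ : ℝ → ENNReal} (h₁ : AEMeasurable Φ₁)
    (h₂ : AEMeasurable Φ₂) (hf₁ : ∫⁻ x, Φ₁ x ≠ ⊤) (hf₂ : ∫⁻ x, Φ₂ x ≠ ⊤)
    (h : ∀ p : ℤ →₀ ℂ, ∫⁻ x, Φ₁ x * ‖trigPoly p x‖ₑ ^ 2 ≤ ∫⁻ x, Φ₂ x * ‖trigPoly p x‖ₑ ^ 2) :
    ∀ᵐ x : ℝ, ∑' k : ℤ, Φ₁ (x + k) ≤ ∑' k : ℤ, Φ₂ (x + k) := by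
  have hm : Measurable ((↑) : ℝ → UnitAddCircle) := AddCircle.measurable_mk'
  have hfin₁ : IsFiniteMeasure (volume.withDensity Φ₁) := isFiniteMeasure_withDensity hf₁
  have hfin₂ : IsFiniteMeasure (volume.withDensity Φ₂) := isFiniteMeasure_withDensity hf₂
  have hle : (volume.withDensity Φ₁).map ((↑) : ℝ → UnitAddCircle) ≤
      (volume.withDensity Φ₂).map ((↑) : ℝ → UnitAddCircle) := by
    refine measure_le_of_forall_trigPoly fun q hq => ?_
    have hqm : Measurable fun x : UnitAddCircle => ‖q x‖ₑ ^ 2 := by fun_prop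
    have hqm' : Measurable fun x : ℝ => ‖q (x : UnitAddCircle)‖ₑ ^ 2 := hqm.comp hm
    obtain ⟨p, hp⟩ := exists_trigPoly_of_mem_span hq
    rw [lintegral_map hqm hm, lintegral_map hqm hm,
      lintegral_withDensity_eq_lintegral_mul₀ h₁ hqm'.aemeasurable,
      lintegral_withDensity_eq_lintegral_mul₀ h₂ hqm'.aemeasurable]
    simpa only [Pi.mul_apply, hp] using h p
  have hshift : ∀ {Φ : ℝ → ENNReal}, AEMeasurable Φ → ∀ k : ℤ,
      AEMeasurable (fun x : ℝ => Φ (x + k)) := fun hΦ k =>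
    hΦ.comp_quasiMeasurePreserving
      (measurePreserving_add_right volume (k : ℝ)).quasiMeasurePreserving
  have key : ∀ a : ℤ, ∀ᵐ x : ℝ, x ∈ Set.Ioc (a : ℝ) (a + 1) →
      ∑' k : ℤ, Φ₁ (x + k) ≤ ∑' k : ℤ, Φ₂ (x + k) := by
    intro a
    rw [← ae_restrict_iff' measurableSet_Ioc]
    refine ae_le_of_forall_setLIntegral_le_of_sigmaFinite₀
      (AEMeasurable.tsum fun k => (hshift h₁ k).restrict) fun s hs _ => ?_
    set E : Set UnitAddCircle :=
      (AddCircle.measurableEquivIoc 1 (a : ℝ)) ⁻¹' (Subtype.val ⁻¹' s) with hE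
    have hEm : MeasurableSet E :=
      (AddCircle.measurableEquivIoc 1 (a : ℝ)).measurable (measurable_subtype_coe hs)
    have hval : ∀ {Φ : ℝ → ENNReal}, AEMeasurable Φ →
        (volume.withDensity Φ).map ((↑) : ℝ → UnitAddCircle) E =
          ∫⁻ x in s, ∑' k : ℤ, Φ (x + k) ∂(volume.restrict (Set.Ioc (a : ℝ) (a + 1))) := by
      intro Φ hΦ
      rw [Measure.map_apply hm hEm, withDensity_apply _ (hm hEm),
        ← lintegral_indicator (hm hEm),
        lintegral_eq_lintegral_Ioc_tsum (a : ℝ) (hΦ.indicator (hm hEm)),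
        ← lintegral_indicator hs]
      refine setLIntegral_congr_fun measurableSet_Ioc fun x hx => ?_
      have hper : ∀ k : ℤ, (x + k ∈ ((↑) : ℝ → UnitAddCircle) ⁻¹' E) ↔ x ∈ s := fun k => by
        have : ((x + k : ℝ) : UnitAddCircle) = x := by
          rw [AddCircle.coe_add]
          simp
        rw [Set.mem_preimage, this, hE, Set.mem_preimage]
        change (AddCircle.equivIoc (1 : ℝ) (a : ℝ) (x : UnitAddCircle) : ℝ) ∈ s ↔ _
        rw [AddCircle.equivIoc_coe_eq hx]
      by_cases hxs : x ∈ s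
      · simp only [Set.indicator_of_mem hxs]
        exact tsum_congr fun k => Set.indicator_of_mem ((hper k).2 hxs) _
      · simp only [Set.indicator_of_notMem hxs]
        exact ENNReal.tsum_eq_zero.2 fun k => Set.indicator_of_notMem (mt (hper k).1 hxs) _
    rw [← hval h₁, ← hval h₂]
    exact hle E
  filter_upwards [ae_all_iff.2 key] with x hx
  refine hx (⌈x⌉ - 1) ?_
  push_cast
  exact ⟨by linarith [Int.ceil_lt_add_one x], by linarith [Int.le_ceil x]⟩

/-! ### Complexification -/

section

section Complexification

open FourierTransform

variable {r : ℕ}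

/-- The space `L²(ℝ; ℂ^r)`. -/
abbrev CVecL2 (r : ℕ) : Type := Lp (EuclideanSpace ℂ (Fin r)) 2 (volume : Measure ℝ)

theorem norm_toLp_add_I_mul_sq (x y : EuclideanSpace ℝ (Fin r)) :
    ‖(WithLp.toLp 2 fun i => (x i : ℂ) + Complex.I * y i : EuclideanSpace ℂ (Fin r))‖ ^ 2 =
      ‖x‖ ^ 2 + ‖y‖ ^ 2 := by
  simp only [EuclideanSpace.norm_sq_eq, ← Finset.sum_add_distrib]
  refine Finset.sum_congr rfl fun i _ => ?_
  rw [← Complex.normSq_eq_norm_sq, mul_comm, Complex.normSq_add_mul_I, Real.norm_eq_abs,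
    Real.norm_eq_abs, sq_abs, sq_abs]

/-- The inclusion `ℝ^r → ℂ^r`. -/
def complexify (r : ℕ) : EuclideanSpace ℝ (Fin r) →ₗᵢ[ℝ] EuclideanSpace ℂ (Fin r) where
  toFun x := WithLp.toLp 2 fun i => (x i : ℂ)
  map_add' x y := by ext; simp
  map_smul' c x := by ext; simp
  norm_map' x := by
    have h := norm_toLp_add_I_mul_sq x 0
    simp only [PiLp.zero_apply, Complex.ofReal_zero, mul_zero, add_zero, norm_zero] at h
    simpa using h

theorem complexify_apply (x : EuclideanSpace ℝ (Fin r)) (i : Fin r) :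
    complexify r x i = (x i : ℂ) := rfl

/-- The inclusion `L²(ℝ; ℝ^r) → L²(ℝ; ℂ^r)`. -/
def complexifyL (r : ℕ) : VecL2 r →L[ℝ] CVecL2 r :=
  (complexify r).toContinuousLinearMap.compLpL 2 volume

theorem coeFn_complexifyL (h : VecL2 r) :
    complexifyL r h =ᵐ[volume] fun x => complexify r (h x) :=
  ContinuousLinearMap.coeFn_compLpL _ h

theorem complexifyL_translate (t : ℝ) (h : VecL2 r) :
    complexifyL r (translate t h) = shiftL t (complexifyL r h) := by
  ext1
  filter_upwards [coeFn_complexifyL (translate t h), coeFn_shiftL t (complexifyL r h),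
    coeFn_shiftL t h, (measurePreserving_sub_right volume t).quasiMeasurePreserving.ae
      (coeFn_complexifyL h)] with x h1 h2 h3 h4
  rw [h1, h2, h4, translate_eq_shiftL, h3]

theorem complexifyL_dilate (j : ℤ) (h : VecL2 r) :
    complexifyL r (dilate j h) =
      scaleL (zpow_ne_zero j (two_ne_zero (α := ℝ))) (complexifyL r h) := by
  ext1
  filter_upwards [coeFn_complexifyL (dilate j h),
    coeFn_scaleL (zpow_ne_zero j (two_ne_zero (α := ℝ))) (complexifyL r h),
    coeFn_scaleL (zpow_ne_zero j (two_ne_zero (α := ℝ))) h,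
    (quasiMeasurePreserving_mul_left (zpow_ne_zero j (two_ne_zero (α := ℝ)))).ae
      (coeFn_complexifyL h)] with x h1 h2 h3 h4
  rw [h1, h2, h4, dilate_eq_scaleL, h3]

theorem inner_complexifyL (g h : VecL2 r) :
    inner ℂ (complexifyL r g) (complexifyL r h) = (inner ℝ g h : ℂ) := by
  rw [L2.inner_def, L2.inner_def, ← integral_complex_ofReal]
  refine integral_congr_ae ?_
  filter_upwards [coeFn_complexifyL g, coeFn_complexifyL h] with x h1 h2
  rw [h1, h2]
  simp [PiLp.inner_apply, complexify_apply]

theorem norm_complexifyL (h : VecL2 r) : ‖complexifyL r h‖ = ‖h‖ := by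
  have h2 : ‖complexifyL r h‖ ^ 2 = ‖h‖ ^ 2 := by
    rw [@norm_sq_eq_re_inner ℂ, inner_complexifyL, real_inner_self_eq_norm_sq]
    exact Complex.ofReal_re _
  exact (pow_left_inj₀ (norm_nonneg _) (norm_nonneg _) two_ne_zero).1 h2

theorem norm_complexifyL_add_I_smul_sq (g h : VecL2 r) :
    ‖complexifyL r g + Complex.I • complexifyL r h‖ ^ 2 = ‖g‖ ^ 2 + ‖h‖ ^ 2 := by
  rw [norm_add_sq (𝕜 := ℂ), inner_smul_right, inner_complexifyL, norm_smul, norm_complexifyL,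
    norm_complexifyL]
  simp

/-- The Fourier transform of a real function, as an element of `L²(ℝ; ℂ^r)`. -/
def hat (h : VecL2 r) : CVecL2 r := 𝓕 (complexifyL r h)

/-- The map `h ↦ ĥ` as a bounded real linear operator. -/
def hatL (r : ℕ) : VecL2 r →L[ℝ] CVecL2 r :=
  ((Lp.fourierTransformₗᵢ ℝ
    (EuclideanSpace ℂ (Fin r))).toLinearIsometry.toContinuousLinearMap.restrictScalars ℝ).comp
    (complexifyL r)

theorem hatL_apply (h : VecL2 r) : hatL r h = hat h := rfl

theorem norm_hat (h : VecL2 r) : ‖hat h‖ = ‖h‖ := by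
  rw [hat, Lp.norm_fourier_eq, norm_complexifyL]

theorem inner_hat (g h : VecL2 r) : inner ℂ (hat g) (hat h) = (inner ℝ g h : ℂ) := by
  rw [hat, hat, Lp.inner_fourier_eq, inner_complexifyL]

theorem coeFn_hat_translate (t : ℝ) (h : VecL2 r) :
    hat (translate t h) =ᵐ[volume] fun x => Real.fourierChar (-t * x) • hat h x := by
  rw [hat, complexifyL_translate, fourier_shiftL]
  exact coeFn_modL _ _

theorem coeFn_hat_dilate (j : ℤ) (h : VecL2 r) :
    hat (dilate j h) =ᵐ[volume] fun x => (2 : ℝ) ^ (-j) • hat h ((2 : ℝ) ^ (-j) * x) := by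
  rw [hat, complexifyL_dilate, fourier_scaleL]
  filter_upwards [Lp.coeFn_smul |((2 : ℝ) ^ j)⁻¹| (scaleL (inv_ne_zero
    (zpow_ne_zero j (two_ne_zero (α := ℝ)))) (𝓕 (complexifyL r h))),
    coeFn_scaleL (inv_ne_zero (zpow_ne_zero j (two_ne_zero (α := ℝ)))) (𝓕 (complexifyL r h))]
    with x h1 h2
  rw [h1, Pi.smul_apply, h2, abs_of_pos (by positivity), zpow_neg]
  rfl

end Complexification

/-! ### The periodized Gramian -/

variable {r : ℕ} {F : ℝ → Matrix (Fin r) (Fin r) ℝ} {hF : IsMatL2 F}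

/-- The Fourier transform of `F` at a point, acting on `ℂ^r`. -/
def fourierMatrix (F : ℝ → Matrix (Fin r) (Fin r) ℝ) (hF : IsMatL2 F) (x : ℝ) :
    EuclideanSpace ℂ (Fin r) →ₗ[ℂ] EuclideanSpace ℂ (Fin r) where
  toFun v := ∑ i, v i • hat (column F hF i) x
  map_add' v w := by simp [add_smul, Finset.sum_add_distrib]
  map_smul' a v := by simp [Finset.smul_sum, mul_smul]

theorem fourierMatrix_apply (x : ℝ) (v : EuclideanSpace ℂ (Fin r)) :
    fourierMatrix F hF x v = ∑ i, v i • hat (column F hF i) x := rfl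

theorem aestronglyMeasurable_fourierMatrix (v : EuclideanSpace ℂ (Fin r)) :
    AEStronglyMeasurable (fun x => fourierMatrix F hF x v) volume := by
  simp only [fourierMatrix_apply]
  exact Finset.aestronglyMeasurable_fun_sum _ fun i _ =>
    (Lp.aestronglyMeasurable (hat (column F hF i))).const_smul (v i)

theorem memLp_fourierMatrix (v : EuclideanSpace ℂ (Fin r)) :
    MemLp (fun x => fourierMatrix F hF x v) 2 volume := by
  simp only [fourierMatrix_apply]
  exact memLp_finsetSum _ fun i _ => (Lp.memLp (hat (column F hF i))).const_smul (v i)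

theorem lintegral_fourierMatrix_sq_ne_top (v : EuclideanSpace ℂ (Fin r)) :
    ∫⁻ x, ‖fourierMatrix F hF x v‖ₑ ^ 2 ≠ ⊤ := by
  have h := enorm_sq_eq_lintegral ((memLp_fourierMatrix (hF := hF) v).toLp _)
  rw [lintegral_congr_ae (g := fun x => ‖fourierMatrix F hF x v‖ₑ ^ 2)] at h
  · rw [← h]
    finiteness
  · filter_upwards [(memLp_fourierMatrix (hF := hF) v).coeFn_toLp] with x hx
    rw [hx]

theorem coeFn_hat_translateMulVec (k : ℤ) (v : EuclideanSpace ℝ (Fin r)) :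
    hat (translateMulVec F hF k v) =ᵐ[volume]
      fun x => Real.fourierChar (-(k : ℝ) * x) • fourierMatrix F hF x (complexify r v) := by
  rw [← hatL_apply, translateMulVec, map_sum]
  filter_upwards [Lp.coeFn_fun_finsetSum Finset.univ
      fun i => hatL r (v i • translate (k : ℝ) (column F hF i)),
    ae_all_iff.2 fun i => Lp.coeFn_smul (v i) (hat (translate (k : ℝ) (column F hF i))),
    ae_all_iff.2 fun i => coeFn_hat_translate (k : ℝ) (column F hF i)] with x h1 h2 h3
  rw [h1, fourierMatrix_apply, Finset.smul_sum]
  refine Finset.sum_congr rfl fun i _ => ?_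
  rw [map_smul, hatL_apply, h2, Pi.smul_apply, h3, complexify_apply, Complex.coe_smul]
  exact smul_comm _ _ _

/-- The convolution of `F` with the real and imaginary parts of `p_k v`, on the Fourier side. -/
theorem coeFn_hat_sum_translateMulVec (p : ℤ →₀ ℂ) (v : EuclideanSpace ℂ (Fin r)) :
    (hat (∑ k ∈ p.support, translateMulVec F hF k fun i => (p k * v i).re) +
      Complex.I • hat (∑ k ∈ p.support, translateMulVec F hF k fun i => (p k * v i).im) :
        CVecL2 r) =ᵐ[volume] fun x => trigPoly p x • fourierMatrix F hF x v := by
  simp only [← hatL_apply, map_sum]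
  set X : ℤ → EuclideanSpace ℝ (Fin r) := fun k => WithLp.toLp 2 fun i => (p k * v i).re with hX
  set Y : ℤ → EuclideanSpace ℝ (Fin r) := fun k => WithLp.toLp 2 fun i => (p k * v i).im with hY
  have hXY : ∀ k, complexify r (X k) + Complex.I • complexify r (Y k) = p k • v := fun k => by
    ext i
    simp only [PiLp.add_apply, PiLp.smul_apply, complexify_apply, smul_eq_mul, hX, hY]
    rw [mul_comm Complex.I, Complex.re_add_im]
  filter_upwards [Lp.coeFn_add (∑ k ∈ p.support, hatL r (translateMulVec F hF k (X k)))
      (Complex.I • ∑ k ∈ p.support, hatL r (translateMulVec F hF k (Y k))),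
    Lp.coeFn_smul Complex.I (∑ k ∈ p.support, hatL r (translateMulVec F hF k (Y k))),
    Lp.coeFn_fun_finsetSum p.support fun k => hatL r (translateMulVec F hF k (X k)),
    Lp.coeFn_fun_finsetSum p.support fun k => hatL r (translateMulVec F hF k (Y k)),
    ae_all_iff.2 fun k => coeFn_hat_translateMulVec (hF := hF) k (X k),
    ae_all_iff.2 fun k => coeFn_hat_translateMulVec (hF := hF) k (Y k)] with x h1 h2 h3 h4 h5 h6
  refine h1.trans ?_
  rw [Pi.add_apply, h2, Pi.smul_apply, h3, h4, trigPoly, Finsupp.sum, Finset.sum_smul,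
    Finset.smul_sum, ← Finset.sum_add_distrib]
  refine Finset.sum_congr rfl fun k _ => ?_
  rw [hatL_apply, hatL_apply, h5, h6, smul_comm Complex.I, ← smul_add,
    ← map_smul (fourierMatrix F hF x) Complex.I, ← map_add, hXY, map_smul, mul_smul,
    Circle.smul_def]
  exact smul_comm _ _ _

theorem norm_sum_translateMulVec_bounds {K₁ K₂ : ℝ} (h1 : 0 < K₁)
    (h : ∀ c : VecSeq2 r, Summable (fun k : ℤ => translateMulVec F hF k (c k)) ∧
      K₁ * ‖c‖ ≤ ‖conv F hF c‖ ∧ ‖conv F hF c‖ ≤ K₂ * ‖c‖)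
    (s : Finset ℤ) (X : ℤ → EuclideanSpace ℝ (Fin r)) :
    K₁ ^ 2 * ∑ k ∈ s, ‖X k‖ ^ 2 ≤ ‖∑ k ∈ s, translateMulVec F hF k (X k)‖ ^ 2 ∧
      ‖∑ k ∈ s, translateMulVec F hF k (X k)‖ ^ 2 ≤ K₂ ^ 2 * ∑ k ∈ s, ‖X k‖ ^ 2 := by
  set c : VecSeq2 r := ∑ k ∈ s, lp.single 2 k (X k) with hc
  have hn : ‖c‖ ^ 2 = ∑ k ∈ s, ‖X k‖ ^ 2 := by
    have := lp.norm_sum_single (p := 2) (by norm_num) X s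
    simpa using this
  have hck : ∀ k, c k = if k ∈ s then X k else 0 := fun k => by
    simp only [hc, lp.coeFn_sum, lp.coeFn_single, Finset.sum_apply, Finset.sum_pi_single]
  have hconv : conv F hF c = ∑ k ∈ s, translateMulVec F hF k (X k) := by
    rw [conv, tsum_eq_sum (s := s)]
    · refine Finset.sum_congr rfl fun k hk => ?_
      rw [hck, if_pos hk]
    · intro k hk
      rw [hck, if_neg hk]
      exact translateMulVec_zero k
  rw [← hconv, ← hn, ← mul_pow, ← mul_pow]
  have h3 := (h c).2
  constructor
  · exact pow_le_pow_left₀ (by positivity) h3.1 2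
  · exact pow_le_pow_left₀ (by positivity) h3.2 2

theorem lintegral_trigPoly_fourierMatrix_bounds {K₁ K₂ : ℝ} (h1 : 0 < K₁)
    (h : ∀ c : VecSeq2 r, Summable (fun k : ℤ => translateMulVec F hF k (c k)) ∧
      K₁ * ‖c‖ ≤ ‖conv F hF c‖ ∧ ‖conv F hF c‖ ≤ K₂ * ‖c‖)
    (p : ℤ →₀ ℂ) (v : EuclideanSpace ℂ (Fin r)) :
    ENNReal.ofReal (K₁ ^ 2) * (‖v‖ₑ ^ 2 * ∑ k ∈ p.support, ‖p k‖ₑ ^ 2) ≤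
        ∫⁻ x, ‖fourierMatrix F hF x v‖ₑ ^ 2 * ‖trigPoly p x‖ₑ ^ 2 ∧
      ∫⁻ x, ‖fourierMatrix F hF x v‖ₑ ^ 2 * ‖trigPoly p x‖ₑ ^ 2 ≤
        ENNReal.ofReal (K₂ ^ 2) * (‖v‖ₑ ^ 2 * ∑ k ∈ p.support, ‖p k‖ₑ ^ 2) := by
  set X : ℤ → EuclideanSpace ℝ (Fin r) := fun k => WithLp.toLp 2 fun i => (p k * v i).re with hX
  set Y : ℤ → EuclideanSpace ℝ (Fin r) := fun k => WithLp.toLp 2 fun i => (p k * v i).im with hY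
  have hXY : ∀ k, ‖X k‖ ^ 2 + ‖Y k‖ ^ 2 = ‖p k‖ ^ 2 * ‖v‖ ^ 2 := fun k => by
    rw [← norm_toLp_add_I_mul_sq, ← mul_pow, ← norm_smul]
    congr 2
    ext i
    simp only [hX, hY, PiLp.smul_apply, smul_eq_mul]
    rw [mul_comm Complex.I, Complex.re_add_im]
  set a : VecL2 r := ∑ k ∈ p.support, translateMulVec F hF k (X k) with ha
  set b : VecL2 r := ∑ k ∈ p.support, translateMulVec F hF k (Y k) with hb
  have hint : ∫⁻ x, ‖fourierMatrix F hF x v‖ₑ ^ 2 * ‖trigPoly p x‖ₑ ^ 2 =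
      ENNReal.ofReal (‖a‖ ^ 2 + ‖b‖ ^ 2) := by
    rw [← norm_complexifyL_add_I_smul_sq, ← Lp.norm_fourier_eq, ENNReal.ofReal_pow (norm_nonneg _),
      ofReal_norm, enorm_sq_eq_lintegral]
    refine lintegral_congr_ae ?_
    filter_upwards [coeFn_hat_sum_translateMulVec (hF := hF) p v] with x hx
    rw [FourierTransform.fourier_add, FourierTransform.fourier_smul]
    refine Eq.trans ?_ (congrArg (fun z => ‖z‖ₑ ^ 2) hx).symm
    rw [enorm_smul, mul_pow, mul_comm]
  have hsum : ENNReal.ofReal (∑ k ∈ p.support, ‖X k‖ ^ 2 + ∑ k ∈ p.support, ‖Y k‖ ^ 2) =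
      ‖v‖ₑ ^ 2 * ∑ k ∈ p.support, ‖p k‖ₑ ^ 2 := by
    rw [← Finset.sum_add_distrib, Finset.mul_sum,
      ENNReal.ofReal_sum_of_nonneg fun _ _ => by positivity]
    refine Finset.sum_congr rfl fun k _ => ?_
    rw [hXY, ENNReal.ofReal_mul (by positivity), ENNReal.ofReal_pow (norm_nonneg _),
      ENNReal.ofReal_pow (norm_nonneg _), ofReal_norm, ofReal_norm, mul_comm]
  rw [hint, ← hsum, ← ENNReal.ofReal_mul (by positivity), ← ENNReal.ofReal_mul (by positivity)]
  have hbX := norm_sum_translateMulVec_bounds h1 h p.support X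
  have hbY := norm_sum_translateMulVec_bounds h1 h p.support Y
  constructor
  · refine ENNReal.ofReal_le_ofReal ?_
    linarith [hbX.1, hbY.1]
  · refine ENNReal.ofReal_le_ofReal ?_
    linarith [hbX.2, hbY.2]

/-- `∑ k, |F̂(x + k) v|²`. -/
def gramSum (F : ℝ → Matrix (Fin r) (Fin r) ℝ) (hF : IsMatL2 F) (x : ℝ)
    (v : EuclideanSpace ℂ (Fin r)) : ENNReal :=
  ∑' k : ℤ, ‖fourierMatrix F hF (x + k) v‖ₑ ^ 2

theorem tsum_indicator_Ioc_add_intCast (a : ENNReal) (x : ℝ) :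
    ∑' k : ℤ, (Set.Ioc (0 : ℝ) (0 + 1)).indicator (fun _ => a) (x + k) = a := by
  rw [tsum_eq_single (1 - ⌈x⌉)]
  · rw [Set.indicator_of_mem]
    push_cast
    exact ⟨by linarith [Int.ceil_lt_add_one x], by linarith [Int.le_ceil x]⟩
  · intro k hk
    rw [Set.indicator_of_notMem]
    rintro ⟨h1, h2⟩
    refine hk ?_
    have : ⌈x⌉ = 1 - k := by
      rw [Int.ceil_eq_iff]
      push_cast
      constructor <;> linarith
    omega

theorem ae_gramSum_bounds_of_vector {K₁ K₂ : ℝ} (h1 : 0 < K₁)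
    (h : ∀ c : VecSeq2 r, Summable (fun k : ℤ => translateMulVec F hF k (c k)) ∧
      K₁ * ‖c‖ ≤ ‖conv F hF c‖ ∧ ‖conv F hF c‖ ≤ K₂ * ‖c‖)
    (v : EuclideanSpace ℂ (Fin r)) :
    ∀ᵐ x, ENNReal.ofReal (K₁ ^ 2) * ‖v‖ₑ ^ 2 ≤ gramSum F hF x v ∧
      gramSum F hF x v ≤ ENNReal.ofReal (K₂ ^ 2) * ‖v‖ₑ ^ 2 := by
  have hm : AEMeasurable (fun x => ‖fourierMatrix F hF x v‖ₑ ^ 2) volume :=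
    (aestronglyMeasurable_fourierMatrix v).enorm.pow_const 2
  have hmc : ∀ a : ENNReal, AEMeasurable ((Set.Ioc (0 : ℝ) (0 + 1)).indicator fun _ => a) volume :=
    fun a => (measurable_const.indicator measurableSet_Ioc).aemeasurable
  have hfin : ∀ a : ENNReal, a ≠ ⊤ →
      ∫⁻ x, (Set.Ioc (0 : ℝ) (0 + 1)).indicator (fun _ => a) x ≠ ⊤ := fun a ha => by
    rw [lintegral_indicator_const measurableSet_Ioc, Real.volume_Ioc]
    finiteness
  have hint : ∀ (a : ENNReal) (p : ℤ →₀ ℂ),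
      ∫⁻ x, (Set.Ioc (0 : ℝ) (0 + 1)).indicator (fun _ => a) x * ‖trigPoly p x‖ₑ ^ 2 =
        a * ∑ k ∈ p.support, ‖p k‖ₑ ^ 2 := fun a p => by
    rw [← lintegral_Ioc_trigPoly_sq, ← lintegral_const_mul _
      ((continuous_trigPoly p).measurable.enorm.pow_const 2),
      ← lintegral_indicator measurableSet_Ioc]
    refine lintegral_congr fun x => ?_
    by_cases hx : x ∈ Set.Ioc (0 : ℝ) (0 + 1)
    · simp only [Set.indicator_of_mem hx]
    · simp only [Set.indicator_of_notMem hx, zero_mul]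
  have hlow := ae_tsum_le_tsum_of_forall_trigPoly
    (hmc (ENNReal.ofReal (K₁ ^ 2) * ‖v‖ₑ ^ 2)) hm (hfin _ (by finiteness))
    (lintegral_fourierMatrix_sq_ne_top v) fun p => by
      rw [hint, mul_assoc]
      exact (lintegral_trigPoly_fourierMatrix_bounds h1 h p v).1
  have hupp := ae_tsum_le_tsum_of_forall_trigPoly hm
    (hmc (ENNReal.ofReal (K₂ ^ 2) * ‖v‖ₑ ^ 2)) (lintegral_fourierMatrix_sq_ne_top v)
    (hfin _ (by finiteness)) fun p => by
      rw [hint, mul_assoc]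
      exact (lintegral_trigPoly_fourierMatrix_bounds h1 h p v).2
  filter_upwards [hlow, hupp] with x hx1 hx2
  rw [tsum_indicator_Ioc_add_intCast] at hx1 hx2
  exact ⟨hx1, hx2⟩

theorem enorm_add_sq_le {E : Type*} [NormedAddCommGroup E] (a b : E) :
    ‖a + b‖ₑ ^ 2 ≤ 2 * ‖a‖ₑ ^ 2 + 2 * ‖b‖ₑ ^ 2 := by
  have := ENNReal_tsum_mul_sq_le (fun _ : Bool => (1 : ENNReal)) fun i => cond i ‖a‖ₑ ‖b‖ₑ
  simp only [tsum_fintype, Fintype.sum_bool, one_mul, one_pow, cond_true, cond_false,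
    one_add_one_eq_two, mul_add] at this
  exact (pow_le_pow_left' (enorm_add_le a b) 2).trans this

theorem gramSum_le_two_mul_add (x : ℝ) (v w : EuclideanSpace ℂ (Fin r)) :
    gramSum F hF x w ≤ 2 * gramSum F hF x v + 2 * gramSum F hF x (w - v) := by
  rw [gramSum, gramSum, gramSum, ← ENNReal.tsum_mul_left, ← ENNReal.tsum_mul_left,
    ← ENNReal.tsum_add]
  refine ENNReal.tsum_le_tsum fun k => ?_
  have h := enorm_add_sq_le (fourierMatrix F hF (x + k) v) (fourierMatrix F hF (x + k) (w - v))
  rwa [← map_add, add_sub_cancel] at h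

/-- The stability bounds as bounds, almost everywhere, for the periodized Gramian of `F̂`. The
factor `2` only serves to pass from a countable dense set of vectors to all vectors. -/
theorem ae_gramSum_bounds {K₁ K₂ : ℝ} (h1 : 0 < K₁)
    (h : ∀ c : VecSeq2 r, Summable (fun k : ℤ => translateMulVec F hF k (c k)) ∧
      K₁ * ‖c‖ ≤ ‖conv F hF c‖ ∧ ‖conv F hF c‖ ≤ K₂ * ‖c‖) :
    ∀ᵐ x, ∀ v, ENNReal.ofReal (K₁ ^ 2) * ‖v‖ₑ ^ 2 ≤ 2 * gramSum F hF x v ∧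
      gramSum F hF x v ≤ ENNReal.ofReal (K₂ ^ 2) * ‖v‖ₑ ^ 2 := by
  filter_upwards [ae_all_iff.2 fun n => ae_gramSum_bounds_of_vector h1 h
    (TopologicalSpace.denseSeq (EuclideanSpace ℂ (Fin r)) n)] with x hx
  have hcont : ∀ y, Continuous fun v => fourierMatrix F hF y v := fun y =>
    LinearMap.continuous_of_finiteDimensional _
  have hupp : ∀ v, gramSum F hF x v ≤ ENNReal.ofReal (K₂ ^ 2) * ‖v‖ₑ ^ 2 := by
    intro v
    refine DenseRange.induction_on (p := fun v => gramSum F hF x v ≤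
      ENNReal.ofReal (K₂ ^ 2) * ‖v‖ₑ ^ 2) (TopologicalSpace.denseRange_denseSeq _) v ?_
      fun n => (hx n).2
    simp only [gramSum, ENNReal.tsum_eq_iSup_sum, iSup_le_iff, Set.ofPred_forall]
    refine isClosed_iInter fun s => isClosed_le ?_ ?_
    · exact continuous_finsetSum _ fun k _ => (ENNReal.continuous_pow 2).comp (hcont _).enorm
    · exact (ENNReal.continuous_const_mul (by finiteness)).comp
        ((ENNReal.continuous_pow 2).comp continuous_enorm)
  refine fun v => ⟨?_, hupp v⟩
  have hw : ∀ w, ENNReal.ofReal (K₁ ^ 2) * ‖w‖ₑ ^ 2 ≤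
      2 * gramSum F hF x v + 2 * (ENNReal.ofReal (K₂ ^ 2) * ‖w - v‖ₑ ^ 2) := by
    intro w
    refine DenseRange.induction_on (p := fun w => ENNReal.ofReal (K₁ ^ 2) * ‖w‖ₑ ^ 2 ≤
      2 * gramSum F hF x v + 2 * (ENNReal.ofReal (K₂ ^ 2) * ‖w - v‖ₑ ^ 2))
      (TopologicalSpace.denseRange_denseSeq _) w ?_ fun n => ?_
    · refine isClosed_le ?_ ?_
      · exact (ENNReal.continuous_const_mul (by finiteness)).comp
          ((ENNReal.continuous_pow 2).comp continuous_enorm)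
      · refine continuous_const.add ((ENNReal.continuous_const_mul (by finiteness)).comp ?_)
        exact (ENNReal.continuous_const_mul (by finiteness)).comp
          ((ENNReal.continuous_pow 2).comp (continuous_id.sub continuous_const).enorm)
    · refine (hx n).1.trans ((gramSum_le_two_mul_add x v _).trans ?_)
      gcongr
      exact hupp _
  simpa using hw v

end

/-! ### The symbol of the mask -/

section

section Symbol

variable {E : Type*} [NormedAddCommGroup E]

theorem log_two_le (k : ℤ) : Real.log 2 ≤ Real.log (2 + |(k : ℝ)|) :=
  Real.log_le_log (by norm_num) (by linarith [abs_nonneg (k : ℝ)])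

theorem summable_norm_of_summable_log {B : ℤ → E}
    (hB : Summable fun k : ℤ => Real.log (2 + |(k : ℝ)|) * ‖B k‖) :
    Summable fun k : ℤ => ‖B k‖ := by
  have h2 : 0 < Real.log 2 := Real.log_pos (by norm_num)
  refine Summable.of_nonneg_of_le (fun k => norm_nonneg _) (fun k => ?_)
    (hB.mul_left (Real.log 2)⁻¹)
  rw [← mul_assoc]
  refine le_mul_of_one_le_left (norm_nonneg _) ?_
  rw [inv_mul_eq_div, one_le_div h2]
  exact log_two_le k

/-- A modulus of continuity for the symbol at distance `2⁻ᵐ`. -/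
def symbolModulus (B : ℤ → E) (m : ℕ) : ℝ :=
  ∑' k : ℤ, ‖B k‖ * min 1 (4 * |(k : ℝ)| * 2⁻¹ ^ m)

theorem min_one_nonneg (k : ℤ) (m : ℕ) : 0 ≤ min 1 (4 * |(k : ℝ)| * (2 : ℝ)⁻¹ ^ m) :=
  le_min zero_le_one (by positivity)

theorem symbolModulus_nonneg (B : ℤ → E) (m : ℕ) : 0 ≤ symbolModulus B m :=
  tsum_nonneg fun k => mul_nonneg (norm_nonneg _) (min_one_nonneg k m)

theorem tsum_min_one_geometric_le (k : ℤ) :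
    Summable (fun m : ℕ => min 1 (4 * |(k : ℝ)| * (2 : ℝ)⁻¹ ^ m)) ∧
      ∑' m : ℕ, min 1 (4 * |(k : ℝ)| * (2 : ℝ)⁻¹ ^ m) ≤
        6 / Real.log 2 * Real.log (2 + |(k : ℝ)|) := by
  have hgeo : Summable fun m : ℕ => 4 * |(k : ℝ)| * (2 : ℝ)⁻¹ ^ m :=
    (summable_geometric_of_lt_one (by norm_num) (by norm_num)).mul_left _
  have hsum : Summable fun m : ℕ => min 1 (4 * |(k : ℝ)| * (2 : ℝ)⁻¹ ^ m) :=
    Summable.of_nonneg_of_le (fun m => min_one_nonneg k m) (fun m => min_le_right _ _) hgeo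
  refine ⟨hsum, ?_⟩
  have h2 : 0 < Real.log 2 := Real.log_pos (by norm_num)
  -- the first `N` terms are at most `1` each, the others sum up to at most `2`
  set N := Nat.log 2 (k.natAbs + 2) + 3 with hN
  have hk : |(k : ℝ)| = (k.natAbs : ℝ) := by rw [Nat.cast_natAbs]; simp
  have hNk : 4 * (|(k : ℝ)| + 2) ≤ 2 ^ N := by
    have := Nat.lt_pow_succ_log_self (b := 2) (by norm_num) (k.natAbs + 2)
    have h3 : ((k.natAbs + 2 : ℕ) : ℝ) ≤ ((2 ^ (Nat.log 2 (k.natAbs + 2)).succ : ℕ) : ℝ) := by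
      exact_mod_cast this.le
    push_cast at h3
    rw [hk, hN, show Nat.log 2 (k.natAbs + 2) + 3 = (Nat.log 2 (k.natAbs + 2)).succ + 2 by omega,
      pow_add]
    linarith
  have hlogN : (Nat.log 2 (k.natAbs + 2) : ℝ) * Real.log 2 ≤ Real.log (2 + |(k : ℝ)|) := by
    rw [← Real.log_pow]
    refine Real.log_le_log (by positivity) ?_
    have := Nat.pow_log_le_self 2 (x := k.natAbs + 2) (by omega)
    rw [hk, add_comm 2]
    exact_mod_cast this
  rw [← hsum.sum_add_tsum_nat_add N]
  have hhead : ∑ m ∈ Finset.range N, min 1 (4 * |(k : ℝ)| * (2 : ℝ)⁻¹ ^ m) ≤ N := by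
    refine (Finset.sum_le_card_nsmul _ _ 1 fun m _ => min_le_left _ _).trans ?_
    simp
  have htail : ∑' m : ℕ, min 1 (4 * |(k : ℝ)| * (2 : ℝ)⁻¹ ^ (m + N)) ≤ 2 := by
    have hb : ∀ m : ℕ, min 1 (4 * |(k : ℝ)| * (2 : ℝ)⁻¹ ^ (m + N)) ≤ (1 / 2 : ℝ) ^ m := fun m => by
      refine (min_le_right _ _).trans ?_
      have h5 : (0 : ℝ) < 2 ^ N := by positivity
      rw [pow_add, mul_comm ((2 : ℝ)⁻¹ ^ m), ← mul_assoc, one_div]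
      refine mul_le_of_le_one_left (by positivity) ?_
      rw [inv_pow, ← div_eq_mul_inv, div_le_one h5]
      linarith
    refine (Summable.tsum_le_tsum hb ((summable_nat_add_iff N).2 hsum)
      summable_geometric_two).trans ?_
    rw [tsum_geometric_two]
  have hfin : (N : ℝ) + 2 ≤ 6 / Real.log 2 * Real.log (2 + |(k : ℝ)|) := by
    rw [div_mul_eq_mul_div, le_div_iff₀ h2, hN]
    push_cast
    nlinarith [log_two_le k]
  linarith

/-- The logarithmic decay of the sequence is what makes the moduli of continuity of its symbol at
the scales `2⁻ᵐ` summable. -/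
theorem summable_symbolModulus {B : ℤ → E}
    (hB : Summable fun k : ℤ => Real.log (2 + |(k : ℝ)|) * ‖B k‖) :
    Summable (symbolModulus B) := by
  set f : ℤ × ℕ → ℝ := fun q => ‖B q.1‖ * min 1 (4 * |(q.1 : ℝ)| * (2 : ℝ)⁻¹ ^ q.2) with hf
  have hf0 : 0 ≤ f := fun q => mul_nonneg (norm_nonneg (B q.1)) (min_one_nonneg q.1 q.2)
  have hin : ∀ k, Summable fun m => f (k, m) := fun k =>
    (tsum_min_one_geometric_le k).1.mul_left ‖B k‖
  have hle : ∀ k : ℤ, ∑' m : ℕ, f (k, m) ≤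
      6 / Real.log 2 * (Real.log (2 + |(k : ℝ)|) * ‖B k‖) := fun k => by
    simp only [hf, tsum_mul_left]
    refine (mul_le_mul_of_nonneg_left (tsum_min_one_geometric_le k).2 (norm_nonneg _)).trans
      (le_of_eq ?_)
    ring
  have hout : Summable fun k : ℤ => ∑' m : ℕ, f (k, m) :=
    Summable.of_nonneg_of_le (fun k => tsum_nonneg fun m => hf0 (k, m)) hle (hB.mul_left _)
  exact ((summable_prod_of_nonneg hf0).2 ⟨hin, hout⟩).prod_symm.prod

theorem tsum_int_even_add_odd [CompleteSpace E] {f : ℤ → E}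
    (hf : Summable f) : ∑' k, f k = ∑' j, f (2 * j) + ∑' j, f (1 + 2 * j) := by
  have h0 : Function.Injective fun j : ℤ => 2 * j := fun a b h => by dsimp only at h; omega
  have h1 : Function.Injective fun j : ℤ => 1 + 2 * j := fun a b h => by dsimp only at h; omega
  have hc : IsCompl (Set.range fun j : ℤ => 2 * j) (Set.range fun j : ℤ => 1 + 2 * j) := by
    refine IsCompl.of_eq ?_ ?_
    · ext k
      simp only [Set.inf_eq_inter, Set.mem_inter_iff, Set.mem_range, Set.bot_eq_empty,
        Set.mem_empty_iff_false, iff_false]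
      rintro ⟨⟨a, ha⟩, b, hb⟩
      omega
    · ext k
      simp only [Set.sup_eq_union, Set.mem_union, Set.mem_range, Set.top_eq_univ, Set.mem_univ,
        iff_true]
      rcases Int.even_or_odd' k with ⟨j, hj | hj⟩
      · exact Or.inl ⟨j, hj.symm⟩
      · exact Or.inr ⟨j, by omega⟩
  exact (HasSum.add_isCompl hc (h0.hasSum_range_iff.2 (hf.comp_injective h0).hasSum)
    (h1.hasSum_range_iff.2 (hf.comp_injective h1).hasSum)).tsum_eq

variable [NormedSpace ℂ E]

/-- The symbol `½ ∑ k, e^{-2πikx} B_k` of a sequence. -/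
def symbol (B : ℤ → E) (x : ℝ) : E :=
  (1 / 2 : ℂ) • ∑' k : ℤ, (Real.fourierChar (-(k : ℝ) * x) : ℂ) • B k

theorem norm_fourierChar_smul (a : ℝ) (b : E) : ‖(Real.fourierChar a : ℂ) • b‖ = ‖b‖ := by
  rw [norm_smul, Circle.norm_coe, one_mul]

theorem fourierChar_intCast (n : ℤ) : Real.fourierChar (n : ℝ) = 1 := by
  ext
  rw [Real.fourierChar_apply, Circle.coe_one, Complex.exp_eq_one_iff]
  exact ⟨n, by push_cast; ring⟩

theorem half_smul_add_self (a : E) : (1 / 2 : ℂ) • (a + a) = a := by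
  rw [← two_smul ℂ a, smul_smul]
  norm_num

theorem symbol_add_intCast (B : ℤ → E) (x : ℝ) (n : ℤ) : symbol B (x + n) = symbol B x := by
  unfold symbol
  congr 2
  ext1 k
  rw [mul_add, AddChar.map_add_eq_mul, show -(k : ℝ) * n = ((-k * n : ℤ) : ℝ) by push_cast; ring,
    fourierChar_intCast, mul_one]

variable [CompleteSpace E]

theorem summable_fourierChar_smul {B : ℤ → E} (hB : Summable fun k => ‖B k‖) (x : ℝ) :
    Summable fun k : ℤ => (Real.fourierChar (-(k : ℝ) * x) : ℂ) • B k :=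
  Summable.of_norm (by simpa only [norm_fourierChar_smul] using hB)

theorem symbol_zero {B : ℤ → E} (hB : Summable fun k => ‖B k‖) :
    symbol B 0 = (1 / 2 : ℂ) • (∑' j, B (2 * j) + ∑' j, B (1 + 2 * j)) := by
  simp only [symbol, mul_zero, AddChar.map_zero_eq_one, Circle.coe_one, one_smul]
  rw [tsum_int_even_add_odd hB.of_norm]

theorem symbol_half {B : ℤ → E} (hB : Summable fun k => ‖B k‖) :
    symbol B (1 / 2) = (1 / 2 : ℂ) • (∑' j, B (2 * j) - ∑' j, B (1 + 2 * j)) := by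
  have he : ∀ j : ℤ, (Real.fourierChar (-((2 * j : ℤ) : ℝ) * (1 / 2)) : ℂ) = 1 := fun j => by
    rw [show -((2 * j : ℤ) : ℝ) * (1 / 2) = ((-j : ℤ) : ℝ) by push_cast; ring,
      fourierChar_intCast, Circle.coe_one]
  have ho : ∀ j : ℤ, (Real.fourierChar (-((1 + 2 * j : ℤ) : ℝ) * (1 / 2)) : ℂ) = -1 := fun j => by
    rw [show -((1 + 2 * j : ℤ) : ℝ) * (1 / 2) = ((-j - 1 : ℤ) : ℝ) + 1 / 2 by push_cast; ring,
      AddChar.map_add_eq_mul, fourierChar_intCast, one_mul, Real.fourierChar_apply,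
      ← Complex.exp_pi_mul_I]
    congr 1
    push_cast
    ring
  rw [symbol, tsum_int_even_add_odd (summable_fourierChar_smul hB _)]
  simp only [he, ho, one_smul, neg_smul, tsum_neg, sub_eq_add_neg]

theorem norm_fourierChar_sub_le (a b : ℝ) :
    ‖(Real.fourierChar a : ℂ) - Real.fourierChar b‖ ≤ 2 * min 1 (4 * |a - b|) := by
  rw [mul_min_of_nonneg _ _ (by norm_num : (0 : ℝ) ≤ 2), le_min_iff]
  constructor
  · refine (norm_sub_le _ _).trans ?_
    rw [Circle.norm_coe, Circle.norm_coe]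
    norm_num
  · have h : (Real.fourierChar a : ℂ) - Real.fourierChar b =
        Real.fourierChar b * (Complex.exp (Complex.I * ((2 * Real.pi * (a - b) : ℝ) : ℂ)) - 1) := by
      rw [mul_sub, mul_one, Real.fourierChar_apply, Real.fourierChar_apply, ← Complex.exp_add]
      congr 2
      push_cast
      ring
    rw [h, norm_mul, Circle.norm_coe, one_mul]
    refine Real.norm_exp_I_mul_ofReal_sub_one_le.trans ?_
    rw [Real.norm_eq_abs, abs_mul, abs_of_pos (by positivity : 0 < 2 * Real.pi)]
    nlinarith [abs_nonneg (a - b), Real.pi_le_four]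

theorem norm_symbol_sub_le {B : ℤ → E} (hB : Summable fun k => ‖B k‖)
    {x y : ℝ} {m : ℕ} (h : |x - y| ≤ 2⁻¹ ^ m) :
    ‖symbol B x - symbol B y‖ ≤ symbolModulus B m := by
  have hsum : Summable fun k : ℤ =>
      ‖B k‖ * min 1 (4 * |(k : ℝ)| * (2 : ℝ)⁻¹ ^ m) :=
    Summable.of_nonneg_of_le (fun k => mul_nonneg (norm_nonneg _) (min_one_nonneg k m))
      (fun k => mul_le_of_le_one_right (norm_nonneg _) (min_le_left _ _))
      hB
  rw [symbol, symbol, ← smul_sub, ← (summable_fourierChar_smul hB x).tsum_sub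
    (summable_fourierChar_smul hB y), norm_smul]
  have hle : ∀ k : ℤ, ‖(Real.fourierChar (-(k : ℝ) * x) : ℂ) • B k -
      (Real.fourierChar (-(k : ℝ) * y) : ℂ) • B k‖ ≤
      2 * (‖B k‖ * min 1 (4 * |(k : ℝ)| * (2 : ℝ)⁻¹ ^ m)) := fun k => by
    rw [← sub_smul, norm_smul, mul_comm ‖B k‖, ← mul_assoc]
    refine mul_le_mul_of_nonneg_right ((norm_fourierChar_sub_le _ _).trans ?_) (norm_nonneg _)
    rw [← mul_sub, abs_mul, abs_neg, ← mul_assoc]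
    gcongr
  have h2 := tsum_of_norm_bounded (hsum.mul_left 2).hasSum hle
  rw [tsum_mul_left] at h2
  have h3 : ‖(1 / 2 : ℂ)‖ = 1 / 2 := by norm_num
  rw [h3, symbolModulus]
  linarith

end Symbol

variable {r : ℕ}

/-- A real matrix acting on `ℂ^r`. -/
def matrixOp (r : ℕ) : Matrix (Fin r) (Fin r) ℝ →L[ℝ]
    (EuclideanSpace ℂ (Fin r) →L[ℂ] EuclideanSpace ℂ (Fin r)) :=
  LinearMap.toContinuousLinearMap
    { toFun := fun M => Matrix.toEuclideanCLM (𝕜 := ℂ) (M.map fun a => (a : ℂ))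
      map_add' := fun M N => by
        rw [← map_add]
        congr 1
        ext
        simp
      map_smul' := fun c M => by
        rw [RingHom.id_apply, ← Complex.coe_smul, ← map_smul]
        congr 1
        ext
        simp }

theorem matrixOp_apply (M : Matrix (Fin r) (Fin r) ℝ) (v : EuclideanSpace ℂ (Fin r)) (i : Fin r) :
    matrixOp r M v i = ∑ j, (M i j : ℂ) * v j := rfl

theorem matrixOp_one : matrixOp r 1 = 1 := by
  ext v i
  rw [matrixOp_apply, Finset.sum_eq_single i]
  · simp
  · intro j _ hj
    simp [Matrix.one_apply_ne' hj]
  · simp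

theorem matrixOp_complexify_single (M : Matrix (Fin r) (Fin r) ℝ) (i : Fin r) :
    matrixOp r M (EuclideanSpace.single i 1) =
      complexify r (WithLp.toLp 2 fun l => M l i) := by
  ext l
  rw [matrixOp_apply, complexify_apply]
  simp

theorem summable_log_mul_norm_matrixOp {A : ℤ → Matrix (Fin r) (Fin r) ℝ} (hA : HasMaskDecay A) :
    Summable fun k : ℤ => Real.log (2 + |(k : ℝ)|) * ‖matrixOp r (A k)‖ := by
  have hlog : ∀ k : ℤ, 0 ≤ Real.log (2 + |(k : ℝ)|) := fun k =>
    Real.log_nonneg (by linarith [abs_nonneg (k : ℝ)])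
  refine Summable.of_nonneg_of_le (fun k => mul_nonneg (hlog k) (norm_nonneg _)) (fun k => ?_)
    (summable_sum (s := Finset.univ) fun a _ => summable_sum (s := Finset.univ) fun b _ =>
      (hA a b).mul_right ‖matrixOp r (Matrix.single a b 1)‖)
  have : ‖matrixOp r (A k)‖ ≤ ∑ a, ∑ b, |A k a b| * ‖matrixOp r (Matrix.single a b 1)‖ := by
    conv_lhs => rw [Matrix.matrix_eq_sum_single (A k), map_sum]
    refine (norm_sum_le _ _).trans (Finset.sum_le_sum fun a _ => ?_)
    rw [map_sum]
    refine (norm_sum_le _ _).trans (Finset.sum_le_sum fun b _ => ?_)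
    rw [show Matrix.single a b (A k a b) = A k a b • Matrix.single a b (1 : ℝ) by simp, map_smul,
      norm_smul, Real.norm_eq_abs]
  refine (mul_le_mul_of_nonneg_left this (hlog k)).trans (le_of_eq ?_)
  simp only [Finset.mul_sum, mul_assoc]

theorem subMaskSum_eq_one {A : ℤ → Matrix (Fin r) (Fin r) ℝ} (hrank : IsFullRank A) :
    subMaskSum A 0 = 1 ∧ subMaskSum A 1 = 1 := by
  have htop : jointEigenspace A = ⊤ := Submodule.eq_top_of_finrank_eq (by
    rw [hrank, Module.finrank_fin_fun])
  have h : ∀ y : Fin r → ℝ, Matrix.toLin' (subMaskSum A 0) y = y ∧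
      Matrix.toLin' (subMaskSum A 1) y = y := fun y => by
    have hy : y ∈ jointEigenspace A := htop ▸ Submodule.mem_top
    rw [jointEigenspace, Submodule.mem_inf, Module.End.mem_eigenspace_iff,
      Module.End.mem_eigenspace_iff, one_smul] at hy
    exact hy
  constructor
  · exact Matrix.toLin'.injective (LinearMap.ext fun y => by rw [(h y).1, Matrix.toLin'_one]; rfl)
  · exact Matrix.toLin'.injective (LinearMap.ext fun y => by rw [(h y).2, Matrix.toLin'_one]; rfl)

theorem summable_mask {A : ℤ → Matrix (Fin r) (Fin r) ℝ} (hA : HasMaskDecay A) : Summable A := by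
  refine Pi.summable.2 fun a => Pi.summable.2 fun b => ?_
  have h2 : 0 < Real.log 2 := Real.log_pos (by norm_num)
  refine Summable.of_norm (Summable.of_nonneg_of_le (fun k => norm_nonneg _) (fun k => ?_)
    ((hA a b).mul_left (Real.log 2)⁻¹))
  rw [← mul_assoc, Real.norm_eq_abs]
  refine le_mul_of_one_le_left (abs_nonneg _) ?_
  rw [inv_mul_eq_div, one_le_div h2]
  exact log_two_le k

theorem tsum_matrixOp_subMask {A : ℤ → Matrix (Fin r) (Fin r) ℝ} (hA : HasMaskDecay A) (ε : ℤ) :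
    ∑' j : ℤ, matrixOp r (A (ε + 2 * j)) = matrixOp r (subMaskSum A ε) := by
  have hinj : Function.Injective fun j : ℤ => ε + 2 * j := fun a b h => by dsimp only at h; omega
  exact ((matrixOp r).map_tsum ((summable_mask hA).comp_injective hinj)).symm

/-- The symbol `½ ∑ k, A_k e^{-2πikx}` of the mask, acting on `ℂ^r`. -/
def maskSymbol (A : ℤ → Matrix (Fin r) (Fin r) ℝ) :
    ℝ → (EuclideanSpace ℂ (Fin r) →L[ℂ] EuclideanSpace ℂ (Fin r)) :=
  symbol fun k => matrixOp r (A k)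

/-- Full rank means that the symbol is the identity at `0`. -/
theorem maskSymbol_zero {A : ℤ → Matrix (Fin r) (Fin r) ℝ} (hA : HasMaskDecay A)
    (hrank : IsFullRank A) : maskSymbol A 0 = 1 := by
  have h0 := tsum_matrixOp_subMask hA 0
  have h1 := tsum_matrixOp_subMask hA 1
  simp only [zero_add] at h0
  rw [maskSymbol, symbol_zero (summable_norm_of_summable_log (summable_log_mul_norm_matrixOp hA)),
    h0, h1, (subMaskSum_eq_one hrank).1, (subMaskSum_eq_one hrank).2, matrixOp_one]
  exact half_smul_add_self _

/-- Full rank means that the symbol vanishes at the half period. -/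
theorem maskSymbol_half {A : ℤ → Matrix (Fin r) (Fin r) ℝ} (hA : HasMaskDecay A)
    (hrank : IsFullRank A) : maskSymbol A (1 / 2) = 0 := by
  have h0 := tsum_matrixOp_subMask hA 0
  have h1 := tsum_matrixOp_subMask hA 1
  simp only [zero_add] at h0
  rw [maskSymbol, symbol_half (summable_norm_of_summable_log (summable_log_mul_norm_matrixOp hA)),
    h0, h1, (subMaskSum_eq_one hrank).1, (subMaskSum_eq_one hrank).2, sub_self]
  exact smul_zero _

end

/-! ### The refinement equation on the Fourier side -/

section

theorem hasSum_fourierChar_smul_map {E E' : Type*} [NormedAddCommGroup E] [NormedSpace ℂ E]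
    [CompleteSpace E] [NormedAddCommGroup E'] [NormedSpace ℂ E'] {B : ℤ → E}
    (hB : Summable fun k => ‖B k‖) (L : E →L[ℂ] E') (x : ℝ) :
    HasSum (fun k : ℤ => (Real.fourierChar (-(k : ℝ) * x) : ℂ) • L (B k))
      ((2 : ℂ) • L (symbol B x)) := by
  have h := (summable_fourierChar_smul hB x).hasSum.mapL L
  simp only [map_smul] at h
  rwa [symbol, map_smul, smul_smul, mul_one_div_cancel two_ne_zero, one_smul]

variable {r : ℕ} {F : ℝ → Matrix (Fin r) (Fin r) ℝ} {hF : IsMatL2 F}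

theorem summable_norm_translateMulVec_mask {A : ℤ → Matrix (Fin r) (Fin r) ℝ}
    (hA : HasMaskDecay A) (i : Fin r) :
    Summable fun k : ℤ => ‖translateMulVec F hF k fun l => A k l i‖ := by
  have h2 : 0 < Real.log 2 := Real.log_pos (by norm_num)
  refine Summable.of_nonneg_of_le (fun k => norm_nonneg _) (fun k => ?_)
    (summable_sum (s := Finset.univ) fun l _ =>
      (((hA l i).mul_left (Real.log 2)⁻¹)).mul_right ‖column F hF l‖)
  refine (norm_sum_le _ _).trans (Finset.sum_le_sum fun l _ => ?_)
  rw [norm_smul, translate_eq_shiftL, LinearIsometry.norm_map, Real.norm_eq_abs, ← mul_assoc]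
  refine mul_le_mul_of_nonneg_right (le_mul_of_one_le_left (abs_nonneg _) ?_) (norm_nonneg _)
  rw [inv_mul_eq_div, one_le_div h2]
  exact log_two_le k

/-- `F̂(x) = F̂(x/2) a(x/2)`, where `a` is the symbol of the mask. -/
theorem ae_fourierMatrix_eq {A : ℤ → Matrix (Fin r) (Fin r) ℝ} (hA : HasMaskDecay A)
    (href : IsRefinable F hF A) :
    ∀ᵐ x, ∀ v, fourierMatrix F hF x v = fourierMatrix F hF (x / 2) (maskSymbol A (x / 2) v) := by
  obtain ⟨G, hG⟩ := href
  have hGhat : ∀ i, ∀ᵐ y, hat (G i) y =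
      (2 : ℂ) • fourierMatrix F hF y (maskSymbol A y (EuclideanSpace.single i 1)) := by
    intro i
    have hsum : hat (G i) = ∑' k : ℤ, hat (translateMulVec F hF k fun l => A k l i) := by
      rw [← hatL_apply, ← (hG i).1.tsum_eq, (hatL r).map_tsum (hG i).1.summable]
      rfl
    have hfin : ∑' k : ℤ, ‖hat (translateMulVec F hF k fun l => A k l i)‖ₑ ≠ ⊤ := by
      have h := (summable_norm_translateMulVec_mask (hF := hF) hA i).tsum_ofReal_ne_top
      simpa only [← ofReal_norm, norm_hat] using h
    filter_upwards [Lp.hasSum_coeFn_tsum hfin, ae_all_iff.2 fun k : ℤ =>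
      coeFn_hat_translateMulVec (hF := hF) k (WithLp.toLp 2 fun l => A k l i)] with y h1 h2
    rw [← hsum] at h1
    let T : EuclideanSpace ℂ (Fin r) →L[ℂ] EuclideanSpace ℂ (Fin r) :=
      LinearMap.toContinuousLinearMap (fourierMatrix F hF y)
    have h3 := hasSum_fourierChar_smul_map
      (summable_norm_of_summable_log (summable_log_mul_norm_matrixOp hA))
      (T.comp (ContinuousLinearMap.apply ℂ (EuclideanSpace ℂ (Fin r))
        (EuclideanSpace.single i (1 : ℂ)))) y
    refine h1.unique (h3.congr_fun fun k => ?_)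
    have h4 := h2 k
    rw [← matrixOp_complexify_single] at h4
    exact h4
  filter_upwards [ae_all_iff.2 fun i => coeFn_hat_dilate 1 (G i),
    ae_all_iff.2 fun i => (quasiMeasurePreserving_mul_left
      (zpow_ne_zero (-1) (two_ne_zero (α := ℝ)))).ae (hGhat i)] with x h1 h2 v
  have hcol : ∀ i, hat (column F hF i) x = fourierMatrix F hF (x / 2)
      (maskSymbol A (x / 2) (EuclideanSpace.single i 1)) := fun i => by
    have hx : (2 : ℝ) ^ (-1 : ℤ) * x = x / 2 := by
      rw [zpow_neg_one, inv_mul_eq_div]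
    have h2i := h2 i
    rw [hx] at h2i
    rw [(hG i).2, h1, hx, h2i, ← Complex.coe_smul, smul_smul]
    simp
  have hv : v = ∑ i, v i • EuclideanSpace.single i (1 : ℂ) := by
    ext j
    simp [Finset.sum_apply, Pi.single_apply]
  conv_rhs => rw [hv]
  simp only [fourierMatrix_apply x, hcol, map_sum, map_smul]

/-- What holds almost everywhere holds along the dyadic orbits `(x + k) / 2^m` of almost every
point. -/
theorem ae_forall_dyadic {P : ℝ → Prop} (h : ∀ᵐ x, P x) :
    ∀ᵐ x : ℝ, ∀ (m : ℕ) (k : ℤ), P ((x + k) / 2 ^ m) := by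
  refine ae_all_iff.2 fun m => ae_all_iff.2 fun k => ?_
  have h1 := (quasiMeasurePreserving_mul_left (inv_ne_zero (pow_ne_zero m
    (two_ne_zero (α := ℝ))))).ae h
  have h2 := (measurePreserving_add_right volume (k : ℝ)).quasiMeasurePreserving.ae h1
  filter_upwards [h2] with x hx
  rwa [div_eq_inv_mul]

/-! ### Invertibility of `F̂` near the origin -/

/-- The product `a(t/2^m) ⋯ a(t/4) a(t/2)`. -/
def cascade (A : ℤ → Matrix (Fin r) (Fin r) ℝ) (t : ℝ) :
    ℕ → EuclideanSpace ℂ (Fin r) → EuclideanSpace ℂ (Fin r)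
  | 0, v => v
  | m + 1, v => maskSymbol A (t / 2 ^ (m + 1)) (cascade A t m v)

theorem maskSymbol_add_intCast (A : ℤ → Matrix (Fin r) (Fin r) ℝ) (x : ℝ) (n : ℤ) :
    maskSymbol A (x + n) = maskSymbol A x := symbol_add_intCast _ x n

/-- Iterating the refinement equation at points that are congruent modulo powers of two, where the
periodicity of the symbol makes its values depend on `t` only. -/
theorem fourierMatrix_add_two_pow_mul {A : ℤ → Matrix (Fin r) (Fin r) ℝ} {t : ℝ}
    (h : ∀ (m : ℕ) (k : ℤ) (v), fourierMatrix F hF ((t + k) / 2 ^ m) v =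
      fourierMatrix F hF ((t + k) / 2 ^ m / 2) (maskSymbol A ((t + k) / 2 ^ m / 2) v))
    (m : ℕ) (k : ℤ) (v : EuclideanSpace ℂ (Fin r)) :
    fourierMatrix F hF (t + 2 ^ m * k) v = fourierMatrix F hF (t / 2 ^ m + k) (cascade A t m v) := by
  induction m generalizing k with
  | zero => simp [cascade]
  | succ m ih =>
    have h1 : (t + 2 ^ (m + 1) * k : ℝ) = t + 2 ^ m * ((2 * k : ℤ) : ℝ) := by
      push_cast
      ring
    have h2 := h m (2 ^ (m + 1) * k) (cascade A t m v)
    have h3 : (t + ((2 ^ (m + 1) * k : ℤ) : ℝ)) / 2 ^ m = t / 2 ^ m + ((2 * k : ℤ) : ℝ) := by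
      push_cast
      rw [pow_succ]
      field_simp
    have h4 : (t / 2 ^ m + ((2 * k : ℤ) : ℝ)) / 2 = t / 2 ^ (m + 1) + k := by
      push_cast
      rw [pow_succ]
      field_simp
    rw [h3, h4, maskSymbol_add_intCast] at h2
    rw [h1, ih, h2, cascade]

theorem exists_eq_two_pow_mul_odd {k : ℤ} (hk : k ≠ 0) :
    ∃ (m : ℕ) (q : ℤ), k = 2 ^ m * (2 * q + 1) := by
  obtain ⟨c, hc, hc'⟩ := (Int.finiteMultiplicity_iff.2 ⟨by norm_num, hk⟩ :
    FiniteMultiplicity 2 k).exists_eq_pow_mul_and_not_dvd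
  obtain ⟨q, rfl⟩ := Int.not_even_iff_odd.1 (mt even_iff_two_dvd.1 hc')
  exact ⟨_, q, hc⟩

/-- A sum over the nonzero integers, split according to the power of two dividing the index. -/
theorem tsum_ite_zero_le (f : ℤ → ENNReal) :
    ∑' k : ℤ, (if k = 0 then 0 else f k) ≤ ∑' m : ℕ, ∑' q : ℤ, f (2 ^ m * (2 * q + 1)) := by
  rw [← ENNReal.tsum_prod (f := fun (m : ℕ) (q : ℤ) => f (2 ^ m * (2 * q + 1)))]
  let e : ℕ × ℤ → {k : ℤ | k ≠ 0} := fun p =>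
    ⟨2 ^ p.1 * (2 * p.2 + 1), mul_ne_zero (by positivity) (by omega)⟩
  have h : ∑' k : ℤ, (if k = 0 then 0 else f k) = ∑' k : {k : ℤ | k ≠ 0}, f k := by
    rw [tsum_subtype]
    refine tsum_congr fun k => ?_
    by_cases hk : k = 0
    · simp [hk]
    · simp [hk]
  rw [h]
  refine ENNReal.tsum_le_tsum_comp_of_surjective (f := e) (fun k => ?_) fun k => f k
  obtain ⟨m, q, h⟩ := exists_eq_two_pow_mul_odd k.2
  exact ⟨(m, q), Subtype.ext h.symm⟩

/-- Since the symbol is the identity at `0`, each factor `a(t/2^j)` has norm at most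
`1 + ω ≤ e^ω`, with `ω` the modulus of continuity at the scale `2^{-(j + M)}`. -/
theorem norm_cascade_le {A : ℤ → Matrix (Fin r) (Fin r) ℝ} (hA : HasMaskDecay A)
    (hrank : IsFullRank A) {t : ℝ} {M : ℕ} (ht : |t| ≤ 2⁻¹ ^ M) (m : ℕ)
    (v : EuclideanSpace ℂ (Fin r)) :
    ‖cascade A t m v‖ ≤ Real.exp (∑ j ∈ Finset.range (m + 1),
      symbolModulus (fun k => matrixOp r (A k)) (j + M)) * ‖v‖ := by
  have hn := summable_norm_of_summable_log (summable_log_mul_norm_matrixOp hA)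
  induction m with
  | zero =>
    refine le_mul_of_one_le_left (norm_nonneg _) (Real.one_le_exp ?_)
    exact Finset.sum_nonneg fun j _ => symbolModulus_nonneg _ _
  | succ m ih =>
    have hdist : |t / 2 ^ (m + 1) - 0| ≤ 2⁻¹ ^ (m + 1 + M) := by
      rw [sub_zero, abs_div, abs_of_pos (by positivity : (0 : ℝ) < 2 ^ (m + 1)), div_eq_mul_inv,
        pow_add _ (m + 1) M, mul_comm, ← inv_pow]
      gcongr
    have hb := norm_symbol_sub_le hn hdist
    have hb2 : ‖maskSymbol A (t / 2 ^ (m + 1))‖ ≤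
        Real.exp (symbolModulus (fun k => matrixOp r (A k)) (m + 1 + M)) := by
      have h0 : maskSymbol A (t / 2 ^ (m + 1)) =
          (maskSymbol A (t / 2 ^ (m + 1)) - maskSymbol A 0) + 1 := by
        rw [maskSymbol_zero hA hrank, sub_add_cancel]
      rw [h0]
      refine (norm_add_le _ _).trans ?_
      have h1 : ‖(1 : EuclideanSpace ℂ (Fin r) →L[ℂ] EuclideanSpace ℂ (Fin r))‖ ≤ 1 :=
        ContinuousLinearMap.norm_id_le
      refine (add_le_add hb h1).trans (Real.add_one_le_exp _)
    rw [cascade, Finset.sum_range_succ _ (m + 1), Real.exp_add, mul_comm (Real.exp _), mul_assoc]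
    exact (ContinuousLinearMap.le_opNorm _ _).trans (mul_le_mul hb2 ih (norm_nonneg _)
      (Real.exp_pos _).le)

theorem tsum_int_eq_add_ite (f : ℤ → ENNReal) :
    ∑' k, f k = f 0 + ∑' k, (if k = 0 then 0 else f k) := by
  rw [ENNReal.tsum_eq_add_tsum_ite 0]
  congr!

/-- Near the origin, the terms with `k ≠ 0` contribute little to `∑ k, |F̂(t + k) v|²`: each of
them contains a factor `a(t/2^m + 1/2)`, which is small since the symbol vanishes at `1/2`. -/
theorem tsum_ne_zero_fourierMatrix_le {A : ℤ → Matrix (Fin r) (Fin r) ℝ} (hA : HasMaskDecay A)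
    (hrank : IsFullRank A) {K η : ℝ} {M : ℕ} {t : ℝ} (ht : |t| ≤ 2⁻¹ ^ M) (hη : η ≤ 1)
    (hMη : ∑' j, symbolModulus (fun k => matrixOp r (A k)) (j + M) ≤ η)
    (href : ∀ (m : ℕ) (k : ℤ) (v), fourierMatrix F hF ((t + k) / 2 ^ m) v =
      fourierMatrix F hF ((t + k) / 2 ^ m / 2) (maskSymbol A ((t + k) / 2 ^ m / 2) v))
    (hgram : ∀ (m : ℕ) (k : ℤ) (v), gramSum F hF ((t + k) / 2 ^ m) v ≤
      ENNReal.ofReal (K ^ 2) * ‖v‖ₑ ^ 2) (v : EuclideanSpace ℂ (Fin r)) :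
    ∑' k : ℤ, (if k = 0 then 0 else ‖fourierMatrix F hF (t + k) v‖ₑ ^ 2) ≤
      ENNReal.ofReal (9 * K ^ 2 * η) * ‖v‖ₑ ^ 2 := by
  set ω : ℕ → ℝ := symbolModulus (fun k => matrixOp r (A k)) with hω
  have hω0 : ∀ j, 0 ≤ ω j := fun j => symbolModulus_nonneg _ _
  have hωs : Summable fun j => ω (j + M) :=
    (summable_nat_add_iff M).2 (summable_symbolModulus (summable_log_mul_norm_matrixOp hA))
  have hωs1 : Summable fun j => ω (j + 1 + M) := (summable_nat_add_iff 1).2 hωs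
  have hsum1 : ∑' j, ω (j + 1 + M) ≤ η := by
    refine le_trans ?_ hMη
    rw [hωs.tsum_eq_zero_add]
    linarith [hω0 (0 + M)]
  have hω1 : ∀ m, ω (m + 1 + M) ≤ 1 := fun m =>
    ((hωs1.le_tsum m fun j _ => hω0 _).trans hsum1).trans hη
  refine (tsum_ite_zero_le fun k : ℤ => ‖fourierMatrix F hF (t + k) v‖ₑ ^ 2).trans ?_
  have hm : ∀ m : ℕ, ∑' q : ℤ,
      ‖fourierMatrix F hF (t + ((2 ^ m * (2 * q + 1) : ℤ) : ℝ)) v‖ₑ ^ 2 ≤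
        ENNReal.ofReal (9 * K ^ 2 * ω (m + 1 + M)) * ‖v‖ₑ ^ 2 := by
    intro m
    set y : ℝ := (t + ((2 ^ m : ℤ) : ℝ)) / 2 ^ (m + 1) with hy
    set w := maskSymbol A y (cascade A t m v) with hw
    have hyt : y = t / 2 ^ (m + 1) + 1 / 2 := by
      rw [hy]
      push_cast
      rw [pow_succ]
      field_simp
    have hterm : ∀ q : ℤ, fourierMatrix F hF (t + ((2 ^ m * (2 * q + 1) : ℤ) : ℝ)) v =
        fourierMatrix F hF (y + q) w := by
      intro q
      have h1 := fourierMatrix_add_two_pow_mul href m (2 * q + 1) v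
      have h2 := href m (2 ^ m * (2 * q + 1)) (cascade A t m v)
      have h3 : (t + ((2 ^ m * (2 * q + 1) : ℤ) : ℝ)) / 2 ^ m =
          t / 2 ^ m + ((2 * q + 1 : ℤ) : ℝ) := by
        push_cast
        field_simp
      have h4 : (t / 2 ^ m + ((2 * q + 1 : ℤ) : ℝ)) / 2 = y + q := by
        rw [hyt]
        push_cast
        rw [pow_succ]
        field_simp
        ring
      rw [h3, h4, maskSymbol_add_intCast, ← h1] at h2
      rw [← h2]
      push_cast
      rfl
    have hwn : ‖w‖ ^ 2 ≤ 9 * ω (m + 1 + M) * ‖v‖ ^ 2 := by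
      have hdist : |y - 1 / 2| ≤ 2⁻¹ ^ (m + 1 + M) := by
        rw [hyt, add_sub_cancel_right, abs_div, abs_of_pos (by positivity : (0 : ℝ) < 2 ^ (m + 1)),
          div_eq_mul_inv, pow_add _ (m + 1) M, mul_comm, ← inv_pow]
        gcongr
      have hb := norm_symbol_sub_le
        (summable_norm_of_summable_log (summable_log_mul_norm_matrixOp hA)) hdist
      have hb2 : ‖maskSymbol A y‖ ≤ ω (m + 1 + M) := by
        rw [← sub_zero (maskSymbol A y), ← maskSymbol_half hA hrank]
        exact hb
      have hc : ‖cascade A t m v‖ ≤ 3 * ‖v‖ := by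
        refine (norm_cascade_le hA hrank ht m v).trans
          (mul_le_mul_of_nonneg_right ?_ (norm_nonneg _))
        have : ∑ j ∈ Finset.range (m + 1), ω (j + M) ≤ 1 :=
          ((hωs.sum_le_tsum _ fun j _ => hω0 _).trans hMη).trans hη
        exact (Real.exp_le_exp.2 this).trans (by linarith [Real.exp_one_lt_d9])
      have hwle : ‖w‖ ≤ ω (m + 1 + M) * (3 * ‖v‖) :=
        (ContinuousLinearMap.le_opNorm _ _).trans (mul_le_mul hb2 hc (norm_nonneg _) (hω0 _))
      calc ‖w‖ ^ 2 ≤ (ω (m + 1 + M) * (3 * ‖v‖)) ^ 2 := pow_le_pow_left₀ (norm_nonneg _) hwle 2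
        _ = ω (m + 1 + M) * (9 * ω (m + 1 + M) * ‖v‖ ^ 2) := by ring
        _ ≤ 9 * ω (m + 1 + M) * ‖v‖ ^ 2 :=
          mul_le_of_le_one_left (by have := hω0 (m + 1 + M); positivity) (hω1 m)
    simp only [hterm]
    refine (hgram (m + 1) (2 ^ m) w).trans ?_
    rw [← ofReal_norm, ← ofReal_norm, ← ENNReal.ofReal_pow (norm_nonneg _),
      ← ENNReal.ofReal_pow (norm_nonneg _), ← ENNReal.ofReal_mul (by positivity),
      ← ENNReal.ofReal_mul (by have := hω0 (m + 1 + M); positivity)]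
    refine ENNReal.ofReal_le_ofReal ?_
    calc K ^ 2 * ‖w‖ ^ 2 ≤ K ^ 2 * (9 * ω (m + 1 + M) * ‖v‖ ^ 2) := by gcongr
      _ = _ := by ring
  refine (ENNReal.tsum_le_tsum hm).trans ?_
  rw [ENNReal.tsum_mul_right]
  gcongr
  rw [← ENNReal.ofReal_tsum_of_nonneg (fun m => by have := hω0 (m + 1 + M); positivity)
    (hωs1.mul_left _), tsum_mul_left]
  gcongr

/-- Almost everywhere near the origin, `F̂` is invertible with bounded inverse, while the values of
`F̂` at the other points of the coset `t + ℤ` are bounded. -/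
theorem exists_fourierMatrix_lower_bound {A : ℤ → Matrix (Fin r) (Fin r) ℝ} (hA : HasMaskDecay A)
    (hrank : IsFullRank A) (href : IsRefinable F hF A) (hs : IsStable F hF) :
    ∃ (M : ℕ) (a C : ENNReal), 1 ≤ M ∧ a ≠ 0 ∧ a ≠ ⊤ ∧ C ≠ ⊤ ∧ ∀ᵐ t : ℝ, |t| ≤ 2⁻¹ ^ M → ∀ v,
      a * ‖v‖ₑ ^ 2 ≤ 2 * ‖fourierMatrix F hF t v‖ₑ ^ 2 ∧
      ∑' k : ℤ, (if k = 0 then 0 else ‖fourierMatrix F hF (t + k) v‖ₑ ^ 2) ≤ C * ‖v‖ₑ ^ 2 := by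
  obtain ⟨K₁, K₂, h1, h2, h⟩ := hs
  have hK2 : 0 < K₂ := h1.trans_le h2
  -- with this `η`, the terms `k ≠ 0` use up at most half of the lower stability bound
  set η : ℝ := min 1 (K₁ ^ 2 / (36 * K₂ ^ 2)) with hη
  have hη0 : 0 < η := lt_min one_pos (by positivity)
  have hη36 : 2 * (9 * K₂ ^ 2 * η) ≤ K₁ ^ 2 / 2 := by
    have := min_le_right 1 (K₁ ^ 2 / (36 * K₂ ^ 2))
    rw [← hη, le_div_iff₀ (by positivity)] at this
    linarith
  have hlim := tendsto_sum_nat_add (symbolModulus fun k => matrixOp r (A k))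
  obtain ⟨M, hM1, hM⟩ := ((Filter.eventually_ge_atTop 1).and
    (hlim.eventually (ge_mem_nhds hη0))).exists
  refine ⟨M, ENNReal.ofReal (K₁ ^ 2 / 2), ENNReal.ofReal (9 * K₂ ^ 2 * η), hM1, ?_,
    ENNReal.ofReal_ne_top, ENNReal.ofReal_ne_top, ?_⟩
  · rw [Ne, ENNReal.ofReal_eq_zero, not_le]
    positivity
  filter_upwards [ae_forall_dyadic (ae_fourierMatrix_eq hA href),
    ae_forall_dyadic (ae_gramSum_bounds h1 h)] with t hr hg ht v
  have hD := tsum_ne_zero_fourierMatrix_le hA hrank ht (min_le_left _ _) hM hr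
    (fun m k v => (hg m k v).2) v
  refine ⟨?_, hD⟩
  have hlow := (hg 0 0 v).1
  have ht0 : (t + ((0 : ℤ) : ℝ)) / 2 ^ 0 = t := by simp
  rw [ht0, gramSum, tsum_int_eq_add_ite, mul_add, Int.cast_zero, add_zero] at hlow
  have hhalf : ENNReal.ofReal (K₁ ^ 2) * ‖v‖ₑ ^ 2 = ENNReal.ofReal (K₁ ^ 2 / 2) * ‖v‖ₑ ^ 2 +
      ENNReal.ofReal (K₁ ^ 2 / 2) * ‖v‖ₑ ^ 2 := by
    rw [← add_mul, ← ENNReal.ofReal_add (by positivity) (by positivity), add_halves]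
  have hD2 : 2 * ∑' k : ℤ, (if k = 0 then 0 else ‖fourierMatrix F hF (t + k) v‖ₑ ^ 2) ≤
      ENNReal.ofReal (K₁ ^ 2 / 2) * ‖v‖ₑ ^ 2 := by
    refine (mul_le_mul_right hD 2).trans ?_
    have h2e : (2 : ENNReal) * ENNReal.ofReal (9 * K₂ ^ 2 * η) =
        ENNReal.ofReal (2 * (9 * K₂ ^ 2 * η)) := by
      rw [ENNReal.ofReal_mul zero_le_two, ENNReal.ofReal_ofNat]
    rw [← mul_assoc, h2e]
    gcongr
  rw [hhalf] at hlow
  exact (ENNReal.add_le_add_iff_right (by finiteness)).1 (hlow.trans (add_le_add_right hD2 _))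

end

/-! ### Functions orthogonal to all translates -/

section

theorem ae_tsum_add_intCast_ne_top {f : ℝ → ENNReal} (hf : AEMeasurable f)
    (hfin : ∫⁻ x, f x ≠ ⊤) : ∀ᵐ x : ℝ, ∑' k : ℤ, f (x + k) ≠ ⊤ := by
  have hm : AEMeasurable (fun x : ℝ => ∑' k : ℤ, f (x + k)) volume :=
    AEMeasurable.tsum fun k => hf.comp_quasiMeasurePreserving
      (measurePreserving_add_right volume (k : ℝ)).quasiMeasurePreserving
  have key : ∀ a : ℤ, ∀ᵐ x : ℝ, x ∈ Set.Ioc (a : ℝ) (a + 1) → ∑' k : ℤ, f (x + k) ≠ ⊤ := by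
    intro a
    rw [← ae_restrict_iff' measurableSet_Ioc]
    filter_upwards [ae_lt_top' hm.restrict (by
      rwa [← lintegral_eq_lintegral_Ioc_tsum (a : ℝ) hf])] with x hx using hx.ne
  filter_upwards [ae_all_iff.2 key] with x hx
  refine hx (⌈x⌉ - 1) ?_
  push_cast
  exact ⟨by linarith [Int.ceil_lt_add_one x], by linarith [Int.le_ceil x]⟩

theorem norm_trigPoly_sq_eq_sum (p : ℤ →₀ ℂ) (x : ℝ) :
    (‖trigPoly p x‖ ^ 2 : ℂ) = ∑ k ∈ p.support, ∑ l ∈ p.support,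
      p k * (starRingEnd ℂ) (p l) * Real.fourierChar (((l - k : ℤ) : ℝ) * x) := by
  have hconj : ∀ y : ℝ, (starRingEnd ℂ) (Real.fourierChar y : ℂ) = Real.fourierChar (-y) :=
    fun y => by rw [AddChar.map_neg_eq_inv, Circle.coe_inv_eq_conj]
  rw [← Complex.mul_conj', trigPoly, Finsupp.sum, map_sum, Finset.sum_mul_sum]
  refine Finset.sum_congr rfl fun k _ => Finset.sum_congr rfl fun l _ => ?_
  rw [map_mul (starRingEnd ℂ), hconj, mul_mul_mul_comm, ← Circle.coe_mul, ← AddChar.map_add_eq_mul]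
  congr 3
  push_cast
  ring

/-- An integrable function on the line whose integrals against `|p|²` vanish, for all trigonometric
polynomials `p` of period one, has a vanishing periodization: its positive and negative parts have
the same one. -/
theorem ae_hasSum_zero_of_forall_integral {φ : ℝ → ℝ} (hφ : Integrable φ)
    (h : ∀ p : ℤ →₀ ℂ, ∫ x, φ x * ‖trigPoly p x‖ ^ 2 = 0) :
    ∀ᵐ x : ℝ, HasSum (fun k : ℤ => φ (x + k)) 0 := by
  have hm : AEMeasurable (fun x => ENNReal.ofReal (φ x)) volume := hφ.1.aemeasurable.ennreal_ofReal
  have hm' : AEMeasurable (fun x => ENNReal.ofReal (-φ x)) volume :=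
    hφ.1.aemeasurable.neg.ennreal_ofReal
  have hf : ∫⁻ x, ENNReal.ofReal (φ x) ≠ ⊤ := hφ.lintegral_lt_top.ne
  have hf' : ∫⁻ x, ENNReal.ofReal (-φ x) ≠ ⊤ := hφ.neg.lintegral_lt_top.ne
  have heq : ∀ p : ℤ →₀ ℂ, ∫⁻ x, ENNReal.ofReal (φ x) * ‖trigPoly p x‖ₑ ^ 2 =
      ∫⁻ x, ENNReal.ofReal (-φ x) * ‖trigPoly p x‖ₑ ^ 2 := by
    intro p
    obtain ⟨C, hC⟩ : ∃ C : ℝ, ∀ x, ‖trigPoly p x‖ ≤ C :=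
      ⟨∑ k ∈ p.support, ‖p k‖, fun x => by
        refine (norm_sum_le _ _).trans (Finset.sum_le_sum fun k _ => ?_)
        rw [norm_mul, Circle.norm_coe, mul_one]⟩
    have hint : Integrable fun x => φ x * ‖trigPoly p x‖ ^ 2 := by
      refine hφ.mul_bdd (c := C ^ 2)
        ((continuous_trigPoly p).norm.pow 2).aestronglyMeasurable
        (Filter.Eventually.of_forall fun x => ?_)
      rw [norm_pow, norm_norm]
      exact pow_le_pow_left₀ (norm_nonneg _) (hC x) 2
    have h1 := integral_eq_lintegral_pos_part_sub_lintegral_neg_part hint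
    rw [h p] at h1
    have hconv : ∀ ψ : ℝ → ℝ, ∫⁻ x, ENNReal.ofReal (ψ x) * ‖trigPoly p x‖ₑ ^ 2 =
        ∫⁻ x, ENNReal.ofReal (ψ x * ‖trigPoly p x‖ ^ 2) := fun ψ => lintegral_congr fun x => by
      rw [ENNReal.ofReal_mul' (by positivity), ENNReal.ofReal_pow (norm_nonneg _), ofReal_norm]
    rw [hconv, hconv fun x => -φ x]
    simp only [neg_mul]
    have hne := hint.neg.lintegral_lt_top.ne
    simp only [Pi.neg_apply] at hne
    exact (ENNReal.toReal_eq_toReal_iff' hint.lintegral_lt_top.ne hne).1 (by linarith)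
  filter_upwards [ae_tsum_le_tsum_of_forall_trigPoly hm hm' hf hf' fun p => (heq p).le,
    ae_tsum_le_tsum_of_forall_trigPoly hm' hm hf' hf fun p => (heq p).ge,
    ae_tsum_add_intCast_ne_top hm hf, ae_tsum_add_intCast_ne_top hm' hf'] with x h1 h2 h3 h4
  have h5 := (ENNReal.hasSum_toReal h3).sub (ENNReal.hasSum_toReal h4)
  rw [← ENNReal.tsum_toReal_eq (ENNReal.ne_top_of_tsum_ne_top h3),
    ← ENNReal.tsum_toReal_eq (ENNReal.ne_top_of_tsum_ne_top h4), le_antisymm h1 h2, sub_self] at h5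
  refine h5.congr_fun fun k => ?_
  rw [ENNReal.toReal_ofReal', ENNReal.toReal_ofReal']
  exact (max_zero_sub_max_neg_zero_eq_self _).symm

theorem integrable_sum_mul (s t : Finset ℤ) (c : ℤ → ℤ → ℂ) {g : ℤ → ℤ → ℝ → ℂ}
    (hg : ∀ k l, Integrable (g k l)) :
    Integrable fun x => ∑ k ∈ s, ∑ l ∈ t, c k l * g k l x :=
  integrable_finsetSum s fun k _ => integrable_finsetSum t fun l _ => (hg k l).const_mul _

theorem integral_sum_mul_eq_zero (s t : Finset ℤ) (c : ℤ → ℤ → ℂ) {g : ℤ → ℤ → ℝ → ℂ}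
    (hg : ∀ k l, Integrable (g k l)) (h : ∀ k l, ∫ x, g k l x = 0) :
    ∫ x, ∑ k ∈ s, ∑ l ∈ t, c k l * g k l x = 0 := by
  have hi : ∀ k l, Integrable fun x => c k l * g k l x := fun k l => (hg k l).const_mul _
  rw [integral_finsetSum (μ := volume) s (f := fun k x => ∑ l ∈ t, c k l * g k l x)
    fun k _ => integrable_finsetSum t fun l _ => hi k l]
  refine Finset.sum_eq_zero fun k _ => ?_
  rw [integral_finsetSum (μ := volume) t (f := fun l x => c k l * g k l x) fun l _ => hi k l]
  refine Finset.sum_eq_zero fun l _ => ?_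
  rw [integral_const_mul, h, mul_zero]

/-- A complex integrable function with vanishing Fourier transform at the integers has a vanishing
periodization. -/
theorem ae_hasSum_zero_of_forall_fourierChar {φ : ℝ → ℂ} (hφ : Integrable φ)
    (h : ∀ k : ℤ, ∫ x, φ x * Real.fourierChar ((k : ℝ) * x) = 0) :
    ∀ᵐ x : ℝ, HasSum (fun k : ℤ => φ (x + k)) 0 := by
  obtain ⟨e, he⟩ : ∃ e : ℤ → ℝ → ℂ, ∀ k x, e k x = Real.fourierChar ((k : ℝ) * x) :=
    ⟨_, fun _ _ => rfl⟩
  have hchar : ∀ k : ℤ, Integrable fun x => φ x * e k x := fun k => by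
    simp only [he]
    exact hφ.mul_bdd (c := 1) (by fun_prop) (Filter.Eventually.of_forall fun x => by
      rw [Circle.norm_coe])
  have hexp : ∀ p : ℤ →₀ ℂ, (fun x => φ x * (‖trigPoly p x‖ ^ 2 : ℂ)) = fun x =>
      ∑ k ∈ p.support, ∑ l ∈ p.support, p k * (starRingEnd ℂ) (p l) * (φ x * e (l - k) x) :=
    fun p => by
      ext x
      simp only [norm_trigPoly_sq_eq_sum, Finset.mul_sum, he]
      exact Finset.sum_congr rfl fun k _ => Finset.sum_congr rfl fun l _ => mul_left_comm _ _ _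
  have hint : ∀ p : ℤ →₀ ℂ, Integrable fun x => φ x * (‖trigPoly p x‖ ^ 2 : ℂ) := fun p => by
    rw [hexp]
    exact integrable_sum_mul p.support p.support (fun k l => p k * (starRingEnd ℂ) (p l))
      (g := fun k l x => φ x * e (l - k) x) fun k l => hchar (l - k)
  have hzero : ∀ p : ℤ →₀ ℂ, ∫ x, φ x * (‖trigPoly p x‖ ^ 2 : ℂ) = 0 := fun p => by
    rw [hexp]
    refine integral_sum_mul_eq_zero p.support p.support (fun k l => p k * (starRingEnd ℂ) (p l))
      (g := fun k l x => φ x * e (l - k) x) (fun k l => hchar (l - k)) fun k l => ?_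
    simp only [he, h]
  have hre : ∀ᵐ x : ℝ, HasSum (fun k : ℤ => (φ (x + k)).re) 0 := by
    have hi : Integrable fun x => (φ x).re := hφ.re
    refine ae_hasSum_zero_of_forall_integral (φ := fun x => (φ x).re) hi fun p => ?_
    have := congrArg Complex.re (hzero p)
    rw [← RCLike.re_eq_complex_re, ← integral_re (hint p)] at this
    rw [← map_zero (RCLike.re (K := ℂ)), ← this]
    congr 1
    ext x
    rw [← Complex.ofReal_pow]
    exact (Complex.re_mul_ofReal _ _).symm
  have him : ∀ᵐ x : ℝ, HasSum (fun k : ℤ => (φ (x + k)).im) 0 := by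
    have hi : Integrable fun x => (φ x).im := hφ.im
    refine ae_hasSum_zero_of_forall_integral (φ := fun x => (φ x).im) hi fun p => ?_
    have := congrArg Complex.im (hzero p)
    rw [← RCLike.im_eq_complex_im, ← integral_im (hint p)] at this
    rw [← map_zero (RCLike.im (K := ℂ)), ← this]
    congr 1
    ext x
    rw [← Complex.ofReal_pow]
    exact (Complex.im_mul_ofReal _ _).symm
  filter_upwards [hre, him] with x h1 h2
  exact (Complex.hasSum_iff _ _).2 ⟨h1, h2⟩

variable {r : ℕ} {F : ℝ → Matrix (Fin r) (Fin r) ℝ} {hF : IsMatL2 F}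

/-- Orthogonality to `V_0` on the Fourier side: orthogonality to the translates of the columns of `F`
is the vanishing of all Fourier coefficients of the periodization of `⟨ĥ, F̂ v⟩`. -/
theorem ae_hasSum_inner_fourierMatrix {hs : IsStable F hF} {h : VecL2 r}
    (hh : ∀ g ∈ baseSpace hs, inner ℝ h g = 0) :
    ∀ᵐ x : ℝ, ∀ v, HasSum (fun k : ℤ =>
      inner ℂ (hat h (x + k)) (fourierMatrix F hF (x + k) v)) 0 := by
  have hcol : ∀ i, ∀ᵐ x : ℝ, HasSum (fun k : ℤ =>
      inner ℂ (hat h (x + k)) (hat (column F hF i) (x + k))) 0 := by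
    intro i
    have hint : Integrable fun x => (inner ℂ (hat h x) (hat (column F hF i) x) : ℂ) :=
      L2.integrable_inner (hat h) (hat (column F hF i))
    refine ae_hasSum_zero_of_forall_fourierChar
      (φ := fun x => inner ℂ (hat h x) (hat (column F hF i) x)) hint fun k => ?_
    have hmem : translate ((-k : ℤ) : ℝ) (column F hF i) ∈ baseSpace hs := by
      have := translateMulVec_mem_baseSpace hs (-k) (Pi.single i 1)
      rwa [translateMulVec_single, one_smul] at this
    have h1 := inner_hat h (translate ((-k : ℤ) : ℝ) (column F hF i))
    rw [hh _ hmem, L2.inner_def] at h1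
    refine Eq.trans (integral_congr_ae ?_) (h1.trans Complex.ofReal_zero)
    filter_upwards [coeFn_hat_translate ((-k : ℤ) : ℝ) (column F hF i)] with x hx
    rw [hx, Circle.smul_def, inner_smul_right, mul_comm]
    push_cast
    rw [neg_neg]
  filter_upwards [ae_all_iff.2 hcol] with x hx v
  have h1 := hasSum_sum (s := Finset.univ) fun i _ => (hx i).mul_left (v i)
  simp only [mul_zero, Finset.sum_const_zero] at h1
  refine h1.congr_fun fun k => ?_
  rw [fourierMatrix_apply, inner_sum]
  exact Finset.sum_congr rfl fun i _ => inner_smul_right _ _ _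

end

/-! ### Density of the union -/

section

theorem enorm_le_tsum_of_hasSum_zero {f : ℤ → ℂ} (hf : HasSum f 0) :
    ‖f 0‖ₑ ≤ ∑' k, if k = 0 then 0 else ‖f k‖ₑ := by
  have h := hasSum_ite_sub_hasSum hf 0
  rw [zero_sub] at h
  rw [← enorm_neg, ← h.tsum_eq]
  refine (enorm_tsum_le_tsum_enorm).trans (ENNReal.tsum_le_tsum fun k => ?_)
  split_ifs <;> simp

variable {r : ℕ} {F : ℝ → Matrix (Fin r) (Fin r) ℝ} {hF : IsMatL2 F}

theorem inner_dilate (j : ℤ) (g h : VecL2 r) :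
    inner ℝ (dilate j g) (dilate j h) = (2 : ℝ) ^ (-j) * inner ℝ g h := by
  rw [L2.inner_def, L2.inner_def]
  have h1 := Measure.integral_comp_mul_left (fun x => inner ℝ (g x) (h x)) ((2 : ℝ) ^ j)
  rw [abs_of_pos (by positivity), ← zpow_neg, smul_eq_mul] at h1
  rw [← h1]
  refine integral_congr_ae ?_
  filter_upwards [coeFn_scaleL (zpow_ne_zero j (two_ne_zero (α := ℝ))) g,
    coeFn_scaleL (zpow_ne_zero j (two_ne_zero (α := ℝ))) h] with x hg hh
  rw [dilate_eq_scaleL, dilate_eq_scaleL, hg, hh]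

theorem inner_dilate_neg_eq_zero {hs : IsStable F hF} {n : ℤ} {h : VecL2 r}
    (hh : ∀ g ∈ scaleSubmodule hs n, inner ℝ h g = 0) :
    ∀ g ∈ baseSpace hs, inner ℝ (dilate (-n) h) g = 0 := by
  intro g hg
  have h1 := inner_dilate (-n) h (dilate n g)
  rwa [hh _ (dilate_mem_scaleSubmodule.2 hg), mul_zero, dilate_dilate, neg_add_cancel,
    dilate_zero] at h1

/-- Near the origin, the Fourier transform of a function orthogonal to `V_0` is controlled by its
values at the other points of the same coset of `ℤ`: the vector `v` with `F̂(t) v = ĥ(t)` turns the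
orthogonality relation into `|ĥ(t)|² = - ∑ k ≠ 0, ⟨ĥ(t + k), F̂(t + k) v⟩`. -/
theorem exists_enorm_hat_sq_le {A : ℤ → Matrix (Fin r) (Fin r) ℝ} (hA : HasMaskDecay A)
    (hrank : IsFullRank A) (href : IsRefinable F hF A) (hs : IsStable F hF) :
    ∃ (M : ℕ) (C : ENNReal), 1 ≤ M ∧ C ≠ ⊤ ∧ ∀ h : VecL2 r,
      (∀ g ∈ baseSpace hs, inner ℝ h g = 0) → ∀ᵐ t : ℝ, |t| ≤ 2⁻¹ ^ M →
        ‖hat h t‖ₑ ^ 2 ≤ C * ∑' k : ℤ, if k = 0 then 0 else ‖hat h (t + k)‖ₑ ^ 2 := by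
  obtain ⟨M, a, C, hM, ha, ha', hC, hF1⟩ := exists_fourierMatrix_lower_bound hA hrank href hs
  refine ⟨M, a⁻¹ * (2 * C), hM, by finiteness, fun h hh => ?_⟩
  filter_upwards [hF1, ae_hasSum_inner_fourierMatrix hh] with t h1 h2 ht
  have hinj : Function.Injective (fourierMatrix F hF t) := by
    rw [injective_iff_map_eq_zero]
    intro v hv
    have h3 := ((h1 ht) v).1
    rw [hv, enorm_zero] at h3
    simpa [ha] using h3
  -- the vector on which the orthogonality relation is tested
  obtain ⟨v, hv⟩ := LinearMap.injective_iff_surjective.1 hinj (hat h t)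
  obtain ⟨h3, h4⟩ := h1 ht v
  have h5 := enorm_le_tsum_of_hasSum_zero (h2 v)
  simp only [Int.cast_zero, add_zero] at h5
  rw [hv] at h3 h5
  set H := ∑' k : ℤ, if k = 0 then 0 else ‖hat h (t + k)‖ₑ ^ 2 with hH
  have hself : ‖(inner ℂ (hat h t) (hat h t) : ℂ)‖ₑ = ‖hat h t‖ₑ ^ 2 := by
    rw [inner_self_eq_norm_sq_to_K, enorm_pow]
    congr 1
    rw [← ofReal_norm, ← ofReal_norm]
    simp
  rw [hself] at h5
  have h6 : (‖hat h t‖ₑ ^ 2) ^ 2 ≤ H * (C * ‖v‖ₑ ^ 2) := by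
    have hprod : ‖hat h t‖ₑ ^ 2 ≤ ∑' k : ℤ, (if k = 0 then 0 else ‖hat h (t + k)‖ₑ) *
        (if k = 0 then 0 else ‖fourierMatrix F hF (t + k) v‖ₑ) := by
      refine h5.trans (ENNReal.tsum_le_tsum fun k => ?_)
      split_ifs
      · exact zero_le
      · rw [← ofReal_norm, ← ofReal_norm (hat h _), ← ofReal_norm (fourierMatrix F hF _ v),
          ← ENNReal.ofReal_mul (norm_nonneg _)]
        exact ENNReal.ofReal_le_ofReal (norm_inner_le_norm _ _)
    refine (pow_le_pow_left' hprod 2).trans ((ENNReal_tsum_mul_sq_le _ _).trans ?_)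
    simp only [ite_pow, ne_eq, OfNat.ofNat_ne_zero, not_false_eq_true, zero_pow]
    gcongr
  by_cases hx : ‖hat h t‖ₑ ^ 2 = 0
  · rw [hx]
    exact zero_le
  have hx' : ‖hat h t‖ₑ ^ 2 ≠ ⊤ := by finiteness
  have h7 : (a * ‖hat h t‖ₑ ^ 2) * ‖hat h t‖ₑ ^ 2 ≤ (2 * C * H) * ‖hat h t‖ₑ ^ 2 := by
    calc (a * ‖hat h t‖ₑ ^ 2) * ‖hat h t‖ₑ ^ 2 = a * (‖hat h t‖ₑ ^ 2) ^ 2 := by ring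
      _ ≤ a * (H * (C * ‖v‖ₑ ^ 2)) := by gcongr
      _ = H * C * (a * ‖v‖ₑ ^ 2) := by ring
      _ ≤ H * C * (2 * ‖hat h t‖ₑ ^ 2) := by gcongr
      _ = (2 * C * H) * ‖hat h t‖ₑ ^ 2 := by ring
  have h8 := (ENNReal.mul_le_mul_iff_left hx hx').1 h7
  calc ‖hat h t‖ₑ ^ 2 = a⁻¹ * (a * ‖hat h t‖ₑ ^ 2) := by
        rw [← mul_assoc, ENNReal.inv_mul_cancel ha ha', one_mul]
    _ ≤ a⁻¹ * (2 * C * H) := by gcongr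
    _ = a⁻¹ * (2 * C) * H := by ring

theorem setLIntegral_tsum_ite_le {f : ℝ → ENNReal} (hf : AEMeasurable f) :
    ∫⁻ t in Set.Ioc (-2⁻¹ : ℝ) 2⁻¹, ∑' k : ℤ, (if k = 0 then 0 else f (t + k)) ≤
      ∫⁻ t in (Set.Ioc (-2⁻¹ : ℝ) 2⁻¹)ᶜ, f t := by
  rw [← lintegral_indicator measurableSet_Ioc.compl,
    lintegral_eq_lintegral_Ioc_tsum (-2⁻¹) (hf.indicator measurableSet_Ioc.compl)]
  norm_num only
  refine setLIntegral_mono' measurableSet_Ioc fun t ht => ENNReal.tsum_le_tsum fun k => ?_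
  split_ifs with hk
  · exact zero_le
  · rw [Set.indicator_of_mem]
    rintro ⟨h1, h2⟩
    have h3 : (-1 : ℝ) < k := by linarith [ht.2]
    have h4 : (k : ℝ) < 1 := by linarith [ht.1]
    have h5 : -1 < k := by exact_mod_cast h3
    have h6 : k < 1 := by exact_mod_cast h4
    omega

/-- The integrated form of `exists_enorm_hat_sq_le`. The interval `(-1/2, 1/2]` contains one point of
each coset of `ℤ`, so the terms `k ≠ 0` only see `ĥ` outside of it. -/
theorem exists_setLIntegral_hat_le {A : ℤ → Matrix (Fin r) (Fin r) ℝ} (hA : HasMaskDecay A)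
    (hrank : IsFullRank A) (href : IsRefinable F hF A) (hs : IsStable F hF) :
    ∃ (δ : ℝ) (C : ENNReal), 0 < δ ∧ C ≠ ⊤ ∧ ∀ h : VecL2 r,
      (∀ g ∈ baseSpace hs, inner ℝ h g = 0) →
        ∫⁻ t in Set.Ioc (-δ) δ, ‖hat h t‖ₑ ^ 2 ≤
          C * ∫⁻ t in (Set.Ioc (-2⁻¹ : ℝ) 2⁻¹)ᶜ, ‖hat h t‖ₑ ^ 2 := by
  obtain ⟨M, C, hM, hC, h1⟩ := exists_enorm_hat_sq_le hA hrank href hs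
  refine ⟨2⁻¹ ^ M, C, by positivity, hC, fun h hh => ?_⟩
  have hδ : (2⁻¹ : ℝ) ^ M ≤ 2⁻¹ := pow_le_of_le_one (by norm_num) (by norm_num) (by omega)
  have hm : AEMeasurable (fun t => ‖hat h t‖ₑ ^ 2) volume :=
    (Lp.aestronglyMeasurable (hat h)).enorm.pow_const 2
  calc ∫⁻ t in Set.Ioc (-2⁻¹ ^ M) (2⁻¹ ^ M), ‖hat h t‖ₑ ^ 2
      ≤ ∫⁻ t in Set.Ioc (-2⁻¹ ^ M) (2⁻¹ ^ M),
        C * ∑' k : ℤ, (if k = 0 then 0 else ‖hat h (t + k)‖ₑ ^ 2) := by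
        refine setLIntegral_mono_ae' measurableSet_Ioc ?_
        filter_upwards [h1 h hh] with t ht hmem
        exact ht (abs_le.2 ⟨hmem.1.le, hmem.2⟩)
    _ ≤ ∫⁻ t in Set.Ioc (-2⁻¹ : ℝ) 2⁻¹,
        C * ∑' k : ℤ, (if k = 0 then 0 else ‖hat h (t + k)‖ₑ ^ 2) :=
        lintegral_mono_set (Set.Ioc_subset_Ioc (neg_le_neg hδ) hδ)
    _ = C * ∫⁻ t in Set.Ioc (-2⁻¹ : ℝ) 2⁻¹,
        ∑' k : ℤ, (if k = 0 then 0 else ‖hat h (t + k)‖ₑ ^ 2) := lintegral_const_mul' _ _ hC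
    _ ≤ _ := mul_le_mul' le_rfl (setLIntegral_tsum_ite_le hm)

theorem setLIntegral_hat_dilate (j : ℤ) (h : VecL2 r) {s : Set ℝ} (hs : MeasurableSet s) :
    ∫⁻ x in (fun x : ℝ => (2 : ℝ) ^ (-j) * x) ⁻¹' s, ‖hat (dilate j h) x‖ₑ ^ 2 =
      ENNReal.ofReal ((2 : ℝ) ^ (-j)) * ∫⁻ x in s, ‖hat h x‖ₑ ^ 2 := by
  have hpre : MeasurableSet ((fun x : ℝ => (2 : ℝ) ^ (-j) * x) ⁻¹' s) :=
    (measurable_const_mul _) hs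
  rw [← lintegral_indicator hpre, ← lintegral_indicator hs]
  have h1 := lintegral_comp_mul_left (s.indicator fun x => ‖hat h x‖ₑ ^ 2)
    (zpow_ne_zero (-j) (two_ne_zero (α := ℝ)))
  have hpos : (0 : ℝ) < 2 ^ (-j) := by positivity
  rw [abs_of_pos (by positivity)] at h1
  have h2 : ∫⁻ x, s.indicator (fun x => ‖hat h x‖ₑ ^ 2) x = ENNReal.ofReal ((2 : ℝ) ^ (-j)) *
      ∫⁻ x, s.indicator (fun x => ‖hat h x‖ₑ ^ 2) ((2 : ℝ) ^ (-j) * x) := by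
    rw [h1, ← mul_assoc, ← ENNReal.ofReal_mul hpos.le, mul_inv_cancel₀ hpos.ne',
      ENNReal.ofReal_one, one_mul]
  rw [h2, ← mul_assoc, ← ENNReal.ofReal_mul hpos.le,
    ← lintegral_const_mul' _ _ ENNReal.ofReal_ne_top]
  refine lintegral_congr_ae ?_
  filter_upwards [coeFn_hat_dilate j h] with x hx
  by_cases hmem : (2 : ℝ) ^ (-j) * x ∈ s
  · rw [Set.indicator_of_mem hmem, Set.indicator_of_mem (by exact hmem), hx, enorm_smul, mul_pow,
      Real.enorm_eq_ofReal hpos.le, ← ENNReal.ofReal_pow hpos.le, sq ((2 : ℝ) ^ (-j))]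
  · rw [Set.indicator_of_notMem hmem, Set.indicator_of_notMem (by exact hmem), mul_zero]

/-- Rescaling the estimate near the origin shows that the energy of `ĥ` on large
intervals is controlled by the energy outside large intervals, which tends to zero. -/
theorem eq_zero_of_forall_orthogonal {A : ℤ → Matrix (Fin r) (Fin r) ℝ} (hA : HasMaskDecay A)
    (hrank : IsFullRank A) (href : IsRefinable F hF A) (hs : IsStable F hF) {h : VecL2 r}
    (hh : ∀ j, ∀ g ∈ scaleSubmodule hs j, inner ℝ h g = 0) : h = 0 := by
  obtain ⟨δ, C, hδ, hC, h1⟩ := exists_setLIntegral_hat_le hA hrank href hs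
  set μ : Measure ℝ := volume.withDensity fun x => ‖hat h x‖ₑ ^ 2 with hμ
  set B : ℝ → ℕ → Set ℝ := fun c n => Set.Ioc (-(2 ^ n * c)) (2 ^ n * c) with hB
  have huniv : μ Set.univ = ‖h‖ₑ ^ 2 := by
    rw [hμ, withDensity_apply _ MeasurableSet.univ, setLIntegral_univ, ← enorm_sq_eq_lintegral,
      ← ofReal_norm, norm_hat, ofReal_norm]
  have hfin : IsFiniteMeasure μ := ⟨by rw [huniv]; finiteness⟩
  have hle : ∀ n, μ (B δ n) ≤ C * μ (B 2⁻¹ n)ᶜ := fun n => by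
    have h2 := h1 _ (inner_dilate_neg_eq_zero (hh (n : ℤ)))
    have hpre : ∀ c : ℝ, Set.Ioc (-c) c =
        (fun x : ℝ => (2 : ℝ) ^ (-(-(n : ℤ))) * x) ⁻¹' B c n := fun c => by
      ext x
      have hpos : (0 : ℝ) < 2 ^ n := by positivity
      simp only [hB, Set.mem_preimage, Set.mem_Ioc, neg_neg, zpow_natCast, ← mul_neg,
        mul_lt_mul_iff_right₀ hpos, mul_le_mul_iff_right₀ hpos]
    rw [hpre δ, hpre 2⁻¹, ← Set.preimage_compl, setLIntegral_hat_dilate _ _ measurableSet_Ioc,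
      setLIntegral_hat_dilate _ _ measurableSet_Ioc.compl, mul_left_comm C] at h2
    rw [hμ, withDensity_apply _ measurableSet_Ioc, withDensity_apply _ measurableSet_Ioc.compl]
    exact (ENNReal.mul_le_mul_iff_right (ENNReal.ofReal_pos.2 (by positivity)).ne'
      ENNReal.ofReal_ne_top).1 h2
  have hmono : ∀ c : ℝ, 0 < c → Monotone (B c) := fun c hc m n hmn => by
    have : (2 : ℝ) ^ m * c ≤ 2 ^ n * c := by gcongr; norm_num
    exact Set.Ioc_subset_Ioc (neg_le_neg this) this
  have hUnion : ∀ c : ℝ, 0 < c → ⋃ n, B c n = Set.univ := fun c hc => by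
    refine Set.eq_univ_of_forall fun x => Set.mem_iUnion.2 ?_
    obtain ⟨n, hn⟩ := pow_unbounded_of_one_lt (|x| / c) (one_lt_two (α := ℝ))
    rw [div_lt_iff₀ hc, abs_lt] at hn
    exact ⟨n, hn.1, hn.2.le⟩
  have hlim1 := tendsto_measure_iUnion_atTop (μ := μ) (hmono δ hδ)
  have hlim2 := tendsto_measure_iInter_atTop (μ := μ) (s := fun n => (B 2⁻¹ n)ᶜ)
    (fun n => measurableSet_Ioc.compl.nullMeasurableSet)
    (fun m n hmn => Set.compl_subset_compl.2 (hmono 2⁻¹ (by norm_num) hmn)) ⟨0, by finiteness⟩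
  rw [← Set.compl_iUnion, hUnion 2⁻¹ (by norm_num), Set.compl_univ, measure_empty] at hlim2
  rw [hUnion δ hδ, huniv] at hlim1
  have h3 := le_of_tendsto_of_tendsto' hlim1
    (ENNReal.Tendsto.const_mul hlim2 (Or.inr hC)) hle
  simpa using h3

theorem closure_iUnion_scaleSubmodule {A : ℤ → Matrix (Fin r) (Fin r) ℝ} (hA : HasMaskDecay A)
    (hrank : IsFullRank A) (href : IsRefinable F hF A) (hs : IsStable F hF) :
    closure (⋃ j, (scaleSubmodule hs j : Set (VecL2 r))) = Set.univ := by
  have hmono : Monotone (scaleSubmodule hs) := monotone_int_of_le_succ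
    (scaleSubmodule_le_succ hs href)
  rw [← Submodule.coe_iSup_of_directed _ hmono.directed_le, ← Submodule.topologicalClosure_coe,
    Submodule.topologicalClosure_eq_top_iff.2, Submodule.top_coe]
  refine (Submodule.eq_bot_iff _).2 fun h hh => ?_
  refine eq_zero_of_forall_orthogonal hA hrank href hs fun j g hg => ?_
  rw [real_inner_comm]
  exact hh g (Submodule.mem_iSup_of_mem j hg)

end

end

end Multichannel

theorem mainTheorem3 {r : ℕ} (F : ℝ → Matrix (Fin r) (Fin r) ℝ) (hF : Multichannel.IsMatL2 F)
    (A : ℤ → Matrix (Fin r) (Fin r) ℝ) (hdecay : Multichannel.HasMaskDecay A)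
    (hrank : Multichannel.IsFullRank A) (href : Multichannel.IsRefinable F hF A)
    (hstable : Multichannel.IsStable F hF) :
    Multichannel.IsMCMRA (Multichannel.scaleSpace F hF) := by
  have hV : Multichannel.scaleSpace F hF = fun j =>
      (Multichannel.scaleSubmodule hstable j : Set (Multichannel.VecL2 r)) :=
    funext fun j => (Multichannel.coe_scaleSubmodule hstable j).symm
  have h0 : Multichannel.scaleSubmodule hstable 0 = Multichannel.baseSpace hstable := by
    ext h
    rw [Multichannel.mem_scaleSubmodule, neg_zero, Multichannel.dilate_zero]
  rw [hV]
  exact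
    { subspace := fun j => ⟨_, rfl⟩
      closed := Multichannel.isClosed_scaleSubmodule hstable
      nested := Multichannel.scaleSubmodule_le_succ hstable href
      shift_invariant := Multichannel.translate_mem_scaleSubmodule_iff hstable
      scaled := fun j h => by
        rw [h0]
        exact Multichannel.dilate_mem_scaleSubmodule.symm
      trivial_inter := by
        refine Set.eq_singleton_iff_unique_mem.2 ⟨Set.mem_iInter.2 fun j => zero_mem _,
          fun h hh => ?_⟩
        exact Multichannel.eq_zero_of_forall_mem_scaleSubmodule hstable (Set.mem_iInter.1 hh)
      dense_union := Multichannel.closure_iUnion_scaleSubmodule hdecay hrank href hstable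
      generated := ⟨Multichannel.column F hF, by
        rw [h0]
        exact Multichannel.baseSpace_eq_closure_span hstable,
        Multichannel.jointlyStable_column hstable⟩ }
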